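/- Let $X$ be a finite alphabet and let $A=(S,X,t,o)$ be a finite automaton with state set $S$, transition map $t:S\times X\to S$ and output map $o:S\times X\to X$, such that $o(s,\cdot)$ is a permutation of $X$ for every $s\in S$. Extend $o(s,\cdot)$ to a permutation of $X^*$ by $o(s,xv)=o(s,x)\,o(t(s,x),v)$, write $s|_v$ for the state reached from $s$ after reading $v\in X^*$, and let $G\le \mathrm{Sym}(X^*)$ be the group generated by all $o(s,\cdot)$, $s\in S$. Assume that different states define different transformations of $X^*$ and that a state $e\in S$ defines the identity transformation. Suppose that $A$ is polynomial of degree $d$: $d$ is the least degree of a polynomial $P$ such that for all $s\in S$ and $n\ge 0$ there are at most $P(n)$ words $v\in X^n$ with $s|_v\ne e$ (the zero polynomial is given degree $0$). For a finite generating set $T=T^{-1}$ of $G$ let $\mathrm{WP}(G,T)$ be the set of words in $T^*$ that represent the identity, and let $\mathrm{DTIME}_*(f(n))$ be the class of languages decided in time $O(f(n))$ by a deterministic multi-tape Turing machine. Then for every such $T$ $$\mathrm{WP}(G,T)\in \mathrm{DTIME}_*\bigl(n(\log n)^{(d+1)^2}\bigr).$$ If moreover $G$ is contracting, then for every such $T$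 $$\mathrm{WP}(G,T)\in \mathrm{DTIME}_*\bigl(n(\log n)^{d+1}\bigr).$$ Here $G$ is called contracting if there is $k\ge 1$ such that $l(w|_v)<|w|$ for all $v\in X^k$ and all sufficiently long words $w$ over $S\cup S^{-1}$, where $(s_1\cdots s_m)|_v=s_1|_{v_1}\cdots s_m|_{v_m}$ with $v_1=v$, $v_{i+1}=s_i(v_i)$, and $l(g)$ is the least length of a word over $S\cup S^{-1}$ representing $g$. -/

import Mathlib

universe u v

/-! ### Deterministic multi-tape Turing machines and `DTIME` -/

/-- A deterministic Turing machine with `extra + 1` two-way infinite tapes and input alphabet `α`.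
The tape alphabet `Γ` is finite, its default element is the blank symbol, and it contains the
input letters as non-blank symbols. In one step the machine reads the symbols under all heads and,
depending on them and on its state, changes the state, rewrites all scanned symbols and moves each
head left, right, or not at all (`none`). -/
structure MultiTapeTM (α : Type u) where
  extra : ℕ
  Γ : Type
  [finΓ : Finite Γ]
  [blank : Inhabited Γ]
  letter : α → Γ
  letter_injective : Function.Injective letter
  letter_ne_blank : ∀ a, letter a ≠ default
  Q : Type
  [finQ : Finite Q]
  start : Q
  accept : Q
  reject : Q
  accept_ne_reject : accept ≠ reject
  δ : Q → (Fin (extra + 1) → Γ) → Q × (Fin (extra + 1) → Γ × Option Turing.Dir)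

namespace MultiTapeTM

variable {α : Type u} (M : MultiTapeTM α)

instance : Finite M.Γ := M.finΓ
instance : Inhabited M.Γ := M.blank
instance : Finite M.Q := M.finQ

/-- A configuration: the state, and all tapes with their head positions. -/
structure Cfg where
  state : M.Q
  tape : Fin (M.extra + 1) → Turing.Tape M.Γ

/-- The initial configuration: the input is on tape `0` with the head on its first letter, and the
other tapes are blank. -/
def init (w : List α) : M.Cfg where
  state := M.start
  tape i := if i = 0 then Turing.Tape.mk₁ (w.map M.letter) else Turing.Tape.mk₁ []

/-- The effect on one tape: write a symbol, then move the head or leave it where it is. -/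
def updateTape (T : Turing.Tape M.Γ) (a : M.Γ × Option Turing.Dir) : Turing.Tape M.Γ :=
  match a.2 with
  | none => T.write a.1
  | some dir => (T.write a.1).move dir

open Classical in
/-- One step of the computation. Configurations in state `accept` or `reject` are halted. -/
noncomputable def step (c : M.Cfg) : M.Cfg :=
  if c.state = M.accept ∨ c.state = M.reject then c
  else
    let r := M.δ c.state (fun i => (c.tape i).head)
    { state := r.1
      tape := fun i => M.updateTape (c.tape i) (r.2 i) }

/-- `M` decides the language `L` in time `T`: on every input `w` it halts after at most
`T |w|` steps, accepting if `w ∈ L` and rejecting if `w ∉ L`. -/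
def DecidesInTime (L : Language α) (T : ℕ → ℕ) : Prop :=
  ∀ w : List α, ∃ m ≤ T w.length,
    (w ∈ L → (M.step^[m] (M.init w)).state = M.accept) ∧
    (w ∉ L → (M.step^[m] (M.init w)).state = M.reject)

end MultiTapeTM

/-- The languages decided in time `O(t(n))` by a deterministic multi-tape Turing machine. -/
def DTIME (t : ℕ → ℝ) (α : Type u) : Set (Language α) :=
  {L | ∃ (M : MultiTapeTM α) (T : ℕ → ℕ), M.DecidesInTime L T ∧
    (fun n => (T n : ℝ)) =O[Filter.atTop] t}

/-! ### Word problems -/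

/-- The word problem of `G` with respect to a set `T` of generators: all words over `T` that
represent the identity. -/
def wordProblem {G : Type u} [Group G] (T : Set G) : Language T :=
  {w : List T | (w.map (fun a => (a : G))).prod = 1}

/-- The word problem of `G` belongs to the class `C` of languages, with respect to every finite
generating set that is closed under inversion. -/
def WordProblemIn (G : Type u) [Group G] (C : (α : Type u) → Set (Language α)) : Prop :=
  ∀ T : Set G, T.Finite → (∀ a ∈ T, a⁻¹ ∈ T) → Subgroup.closure T = ⊤ → wordProblem T ∈ C T

/-! ### Automata and automaton groups -/

/-- An invertible automaton with set of states `S` over the alphabet `X`: the transition map `t`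
and the output map `o`, where each `o s` is a permutation of `X`. -/
structure InvAutomaton (S : Type u) (X : Type v) where
  t : S → X → S
  o : S → Equiv.Perm X

namespace InvAutomaton

variable {S : Type u} {X : Type v} (A : InvAutomaton S X)

/-- The state `t(s, v)` reached from `s` after processing the word `v`, i.e. the section `s|_v`. -/
def sec : S → List X → S
  | s, [] => s
  | s, x :: v => sec (A.t s x) v

/-- The output word `o(s, v)`. -/
def out : S → List X → List X
  | _, [] => []
  | s, x :: v => A.o s x :: out (A.t s x) v

/-- The inverse of the transformation `o(s, ·)`. -/
def outInv : S → List X → List X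
  | _, [] => []
  | s, y :: v => (A.o s).symm y :: outInv (A.t s ((A.o s).symm y)) v

theorem outInv_out (s : S) (v : List X) : A.outInv s (A.out s v) = v := by
  induction v generalizing s with
  | nil => rfl
  | cons x v ih => simp [out, outInv, ih]

theorem out_outInv (s : S) (v : List X) : A.out s (A.outInv s v) = v := by
  induction v generalizing s with
  | nil => rfl
  | cons x v ih => simp [out, outInv, ih]

/-- The transformation `o(s, ·)` of the set of all words, as a permutation. -/
def act (s : S) : Equiv.Perm (List X) where
  toFun := A.out s
  invFun := A.outInv s
  left_inv := A.outInv_out s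
  right_inv := A.out_outInv s

/-- The automaton group: the group of permutations of words generated by the states. -/
def group : Subgroup (Equiv.Perm (List X)) :=
  Subgroup.closure (Set.range A.act)

/-- Different states define different transformations. -/
def IsMinimal : Prop := Function.Injective A.act

/-- The activity of `s` away from the trivial state `e` is bounded by the polynomial `P`: for every
state `s` and every `n` there are at most `P(n)` words `v` of length `n` with `s|_v ≠ e`. -/
def ActivityBound (e : S) (P : Polynomial ℝ) : Prop :=
  ∀ (s : S) (n : ℕ),
    (({v : List X | v.length = n ∧ A.sec s v ≠ e}.ncard : ℕ) : ℝ) ≤ P.eval (n : ℝ)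

/-- `A`, with trivial state `e`, is a polynomial automaton of degree `d`: the least degree of a
polynomial bounding the activity is `d`. -/
def IsPolynomialOfDegree (e : S) (d : ℕ) : Prop :=
  IsLeast {m : ℕ | ∃ P : Polynomial ℝ, P.natDegree = m ∧ A.ActivityBound e P} d

/-- The section `w|_v` of a word `w` of states at a word `v` of letters; words of states act from
left to right, so that `(s w)|_v = s|_v w|_{s(v)}`. -/
def wordSec : List S → List X → List S
  | [], _ => []
  | s :: w, v => A.sec s v :: wordSec w (A.act s v)

/-- The transformation represented by a word of states (the first letter acts first). -/
def element : List S → Equiv.Perm (List X)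
  | [] => 1
  | s :: w => element w * A.act s

/-- The length `l_S(g)`: the least length of a word of states that represents `g`. -/
noncomputable def wordLength (g : Equiv.Perm (List X)) : ℕ :=
  sInf {n : ℕ | ∃ u : List S, u.length = n ∧ A.element u = g}

/-- The disjoint union of `A` (left copy) with its inverse automaton (right copy), so that the
states form a set of generators closed under inversion. -/
def symmetrization : InvAutomaton (S ⊕ S) X where
  t
    | Sum.inl s, x => Sum.inl (A.t s x)
    | Sum.inr s, y => Sum.inr (A.t s ((A.o s).symm y))
  o
    | Sum.inl s => A.o s
    | Sum.inr s => (A.o s)⁻¹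

/-- The automaton group of `A` is contracting: for some power `X^k`, `k ≥ 1`, of the alphabet,
`l_S(w|_v) < |w|` for all `v ∈ X^k` and all sufficiently long words `w` over the states and their
inverses. In particular this holds if it does with `k = 1`. -/
def IsContracting : Prop :=
  ∃ k : ℕ, 1 ≤ k ∧ ∃ N : ℕ, ∀ w : List (S ⊕ S), N ≤ w.length →
    ∀ v : List X, v.length = k →
      A.symmetrization.wordLength
        (A.symmetrization.element (A.symmetrization.wordSec w v)) < w.length

end InvAutomaton

/-! A word over the generators of the group is rewritten as a word `w` of states of `A` and of its
inverse automaton. It represents the identity exactly if its sections on all levels fix all letters.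
Two questions remain: how deep to look, and how large the sections become there.

Size: the states of `w` permute the words of letters, so the nontrivial states in all sections on
level `i` number at most the sum of the activities of the letters of `w`, which is `n * O(i ^ d)`.
If nontriviality shows by a level of order `(log n) ^ D`, a machine that makes one pass per level
over the list of sections, deleting trivial states, needs time `n * (log n) ^ (D * (d + 1))`
(`sum_length_iterate_le`, `runs_wordProblemMachine`, `mem_DTIME_of_triv_level`). The two claims are
the cases `D = d + 1` and `D = 1`.

Depth in general: if along every path the section is the same word before and after some letter at
depth at most `R`, that letter can be cut out, and level `R + 1` decides triviality
(`triv_of_pause`). To find such pauses, states are ranked by the growth of their activity. Over a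
suitable power of the alphabet a state that keeps its positive rank becomes one that loops at one
letter and loses rank at all others (`exists_power_ranked`). Consider two neighbouring looping
states of top rank. Either one misses its letter and drops, or the word of lower rank between them
stabilises and all three fuse into a block. So the number of blocks halves in each round
(`Blocks.halve`), and about `log n` rounds leave a single block. While it survives, what lies right
of it has constant input and what lies left of it has constant output, so both stabilise, the left
part because it can be run backwards (`exists_pause`). Each positive rank costs a factor `log n`,
and ranks are at most `d + 1`.

Depth for contracting groups: a fixed number of letters halves the length of an element until it is
bounded. After `O(log n)` levels only finitely many elements are possible, and a constant number of
further levels decides (`Shortens.exists_triv_level`). -/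

namespace InvAutomaton

variable {S : Type u} {X : Type v} (A : InvAutomaton S X)

/-! ### Words of states reading single letters -/

/-- The section of a word of states at a single letter. -/
def wstep : List S → X → List S
  | [], _ => []
  | s :: w, y => A.t s y :: wstep w (A.o s y)

/-- The image of a letter under a word of states; the first state acts first. -/
def wout : List S → X → X
  | [], y => y
  | s :: w, y => wout w (A.o s y)

/-- The sections of the word `w` along the sequence of letters `ys`. -/
def run (w : List S) (ys : ℕ → X) : ℕ → List S
  | 0 => w
  | k + 1 => A.wstep (run w ys k) (ys k)

/-- The output sequence of the word `w` on the input sequence `ys`. -/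
def outs (w : List S) (ys : ℕ → X) (k : ℕ) : X := A.wout (A.run w ys k) (ys k)

/-- The word `w` fixes all words of letters of length `k`. -/
def triv : ℕ → List S → Prop
  | 0, _ => True
  | k + 1, w => (∀ x, A.wout w x = x) ∧ ∀ x, triv k (A.wstep w x)

theorem wstep_append (u v : List S) (y : X) :
    A.wstep (u ++ v) y = A.wstep u y ++ A.wstep v (A.wout u y) := by
  induction u generalizing y with
  | nil => rfl
  | cons s u ih => simp [wstep, wout, ih]

theorem wout_append (u v : List S) (y : X) :
    A.wout (u ++ v) y = A.wout v (A.wout u y) := by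
  induction u generalizing y with
  | nil => rfl
  | cons s u ih => simp [wout, ih]

@[simp] theorem length_wstep (w : List S) (y : X) : (A.wstep w y).length = w.length := by
  induction w generalizing y with
  | nil => rfl
  | cons s u ih => simp [wstep, ih]

theorem wout_injective (w : List S) : Function.Injective (A.wout w) := by
  induction w with
  | nil => exact fun _ _ h => h
  | cons s w ih => exact fun a b h => (A.o s).injective (ih h)

@[simp] theorem length_run (w : List S) (ys : ℕ → X) (k : ℕ) :
    (A.run w ys k).length = w.length := by
  induction k with
  | zero => rfl
  | succ k ih => simp [run, ih]

theorem run_append (u v : List S) (ys : ℕ → X) (k : ℕ) :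
    A.run (u ++ v) ys k = A.run u ys k ++ A.run v (A.outs u ys) k := by
  induction k with
  | zero => rfl
  | succ k ih => simp [run, ih, wstep_append, outs]

theorem run_add (w : List S) (ys : ℕ → X) (j k : ℕ) :
    A.run w ys (j + k) = A.run (A.run w ys j) (fun i => ys (j + i)) k := by
  induction k with
  | zero => rfl
  | succ k ih => rw [← add_assoc]; simp [run, ih]

theorem run_congr (w : List S) {ys zs : ℕ → X} {k : ℕ} (h : ∀ i < k, ys i = zs i) :
    A.run w ys k = A.run w zs k := by
  induction k with
  | zero => rfl
  | succ k ih => simp [run, ih fun i hi => h i (hi.trans k.lt_succ_self), h k k.lt_succ_self]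

theorem outs_add (w : List S) (ys : ℕ → X) (j k : ℕ) :
    A.outs w ys (j + k) = A.outs (A.run w ys j) (fun i => ys (j + i)) k := by
  simp [outs, run_add]

theorem outs_append (u v : List S) (ys : ℕ → X) (k : ℕ) :
    A.outs (u ++ v) ys k = A.outs v (A.outs u ys) k := by
  simp [outs, run_append, wout_append]

/-! ### The inverse automaton -/

/-- The automaton of the inverse transformations. -/
def inverse : InvAutomaton S X where
  t s y := A.t s ((A.o s).symm y)
  o s := (A.o s)⁻¹

theorem inverse_wout (w : List S) (y : X) : A.inverse.wout w.reverse (A.wout w y) = y := by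
  induction w generalizing y with
  | nil => rfl
  | cons s w ih =>
    rw [List.reverse_cons, wout_append, show A.wout (s :: w) y = A.wout w (A.o s y) from rfl, ih]
    simp [wout, inverse]

theorem inverse_wstep (w : List S) (y : X) :
    A.inverse.wstep w.reverse (A.wout w y) = (A.wstep w y).reverse := by
  induction w generalizing y with
  | nil => rfl
  | cons s w ih =>
    simp only [wstep, List.reverse_cons, wstep_append, wout, ih, inverse_wout]
    simp [inverse]

/-- Running backwards exchanges inputs and outputs, so knowledge of the outputs of a word becomes
knowledge of the inputs of its inverse. -/
theorem inverse_run (w : List S) (ys : ℕ → X) (k : ℕ) :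
    A.inverse.run w.reverse (A.outs w ys) k = (A.run w ys k).reverse := by
  induction k with
  | zero => rfl
  | succ k ih => simp [run, ih, outs, inverse_wstep]

/-! ### Triviality on levels -/

theorem triv_succ_imp {k : ℕ} {w : List S} (h : A.triv (k + 1) w) : A.triv k w := by
  induction k generalizing w with
  | zero => trivial
  | succ k ih => exact ⟨h.1, fun x => ih (h.2 x)⟩

theorem triv_mono {j k : ℕ} (hjk : j ≤ k) {w : List S} (h : A.triv k w) : A.triv j w := by
  induction hjk with
  | refl => exact h
  | step _ ih => exact ih (A.triv_succ_imp h)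

theorem triv_iff_outs (k : ℕ) (w : List S) [Nonempty X] :
    A.triv k w ↔ ∀ (ys : ℕ → X), ∀ i < k, A.outs w ys i = ys i := by
  induction k generalizing w with
  | zero => simp [triv]
  | succ k ih =>
    simp only [triv, ih]
    constructor
    · rintro ⟨h1, h2⟩ ys i hi
      cases i with
      | zero => exact h1 _
      | succ i =>
        have := h2 (ys 0) (fun i => ys (1 + i)) i (by omega)
        rw [add_comm i 1, outs_add]
        exact this
    · intro h
      refine ⟨fun x => h (fun _ => x) 0 (by omega), fun x ys i hi => ?_⟩
      have := h (fun i => if i = 0 then x else ys (i - 1)) (1 + i) (by omega)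
      rw [outs_add] at this
      simpa [run, show ∀ j, 1 + j ≠ 0 by omega] using this

/-- If every path of sections of `w` pauses within `R` steps, then the triviality of `w` is
visible on level `R + 1`. -/
theorem triv_of_pause {R : ℕ} {w : List S}
    (hR : ∀ ys : ℕ → X, ∃ k ≤ R, A.run w ys (k + 1) = A.run w ys k)
    (h : A.triv (R + 1) w) (k : ℕ) : A.triv k w := by
  rcases isEmpty_or_nonempty X with hX | hX
  · cases k with
    | zero => trivial
    | succ k => exact ⟨fun x => hX.elim x, fun x => hX.elim x⟩
  rw [triv_iff_outs] at h ⊢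
  have key : ∀ k, ∀ (ys : ℕ → X) x, A.wout (A.run w ys k) x = x := by
    intro k
    induction k with
    | zero => exact fun ys x => h (fun _ => x) 0 (by omega)
    | succ k ih =>
      intro ys x
      -- Depths up to `R` are covered by `h`. At a greater depth `k + 1` the path pauses at some `j
      -- ≤ R ≤ k`; deleting its letter `j` gives a path of length `k` that ends in the same word of
      -- states.
      obtain ⟨j, hj, hrun⟩ := hR ys
      by_cases hk : k + 1 ≤ R
      · have := h (fun i => if i = k + 1 then x else ys i) (k + 1) (by omega)
        rw [outs, A.run_congr w (zs := ys) (fun i hi => by simp [hi.ne])] at this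
        simpa using this
      · have hcut := ih (fun i => if i < j then ys i else ys (i + 1)) x
        obtain ⟨l, rfl⟩ : ∃ l, k = j + l := ⟨k - j, by omega⟩
        rw [run_add, A.run_congr w (zs := ys) (fun i hi => by simp [hi]), ← hrun] at hcut
        rw [show j + l + 1 = (j + 1) + l by omega, run_add]
        simpa [show ∀ i, j + i + 1 = j + 1 + i by intro i; omega] using hcut
  exact fun ys i _ => key i ys (ys i)

/-! ### Ranked automata -/

/-- The state `s` loops at the letter `x`, and its other sections have lower rank. -/
def Settled (r : S → ℕ) (s : S) (x : X) : Prop :=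
  A.t s x = s ∧ ∀ z, z ≠ x → r (A.t s z) < r s

/-- A rank function that does not increase along transitions, such that states of rank zero
become absorbing after one letter, and states of positive rank drop in rank or become settled
after one letter. -/
structure Ranked (r : S → ℕ) : Prop where
  mono : ∀ s y, r (A.t s y) ≤ r s
  zero : ∀ s y z, r s = 0 → A.t (A.t s y) z = A.t s y
  settled : ∀ s y, r s ≠ 0 → r (A.t s y) = r s → ∃ x, A.Settled r (A.t s y) x

/-- All letters of the word have rank less than `c`. -/
def Low (r : S → ℕ) (c : ℕ) (w : List S) : Prop := ∀ s ∈ w, r s < c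

variable {A} {r : S → ℕ}

/-- At each state the transitions are the old ones up to a permutation of the letters; a looping
letter is replaced by its image. -/
theorem Ranked.inverse (h : A.Ranked r) : A.inverse.Ranked r where
  mono s y := h.mono s _
  zero s y z hs := h.zero s _ _ hs
  settled s y hs hr := by
    obtain ⟨x, hx, hx'⟩ := h.settled s _ hs hr
    refine ⟨A.o (A.inverse.t s y) x, ?_, fun z hz => hx' _ fun hzx => hz ?_⟩
    · simpa [InvAutomaton.inverse] using hx
    · rw [← hzx]; simp [InvAutomaton.inverse]

theorem Low.append {c : ℕ} {u v : List S} (hu : Low r c u) (hv : Low r c v) :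
    Low r c (u ++ v) := fun s hs => (List.mem_append.1 hs).elim (hu s) (hv s)

theorem Low.reverse {c : ℕ} {u : List S} (hu : Low r c u) : Low r c u.reverse :=
  fun s hs => hu s (List.mem_reverse.1 hs)

theorem Low.wstep (h : A.Ranked r) {c : ℕ} {w : List S} (hw : Low r c w) (y : X) :
    Low r c (A.wstep w y) := by
  induction w generalizing y with
  | nil => exact hw
  | cons s w ih =>
    intro s' hs'
    rcases List.mem_cons.1 hs' with rfl | hs'
    · exact (h.mono s y).trans_lt (hw s (by simp))
    · exact ih (fun a ha => hw a (List.mem_cons_of_mem _ ha)) _ s' hs'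

theorem Low.run (h : A.Ranked r) {c : ℕ} {w : List S} (hw : Low r c w) (ys : ℕ → X) (k : ℕ) :
    Low r c (A.run w ys k) := by
  induction k with
  | zero => exact hw
  | succ k ih => exact ih.wstep h _

/-! ### Blocks of settled states -/

variable (A r) in
/-- Words that persist along a constant input sequence `x` with constant output `z`, made of
settled letters of rank `c` and words of lower rank between them. -/
inductive Block (c : ℕ) : List S → X → X → Prop
  | single {s : S} {x : X} (hs : r s = c) (h : A.Settled r s x) : Block c [s] x (A.o s x)
  | join {a u b : List S} {x y x' z : X} (ha : Block c a x y) (hu : Low r c u)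
      (huo : ∀ k, A.outs u (fun _ => y) k = x') (hb : Block c b x' z) :
      Block c (a ++ u ++ b) x z

theorem Block.wout_eq {c : ℕ} {b : List S} {x z : X} (h : Block A r c b x z) :
    A.wout b x = z := by
  induction h with
  | single hs h => rfl
  | join ha hu huo hb iha ihb =>
    rw [wout_append, wout_append, iha, ← ihb]
    exact congrArg _ (huo 0)

/-- The settled letters loop, and the output of an intermediate word along its constant input is
still constant from the second step on. -/
theorem Block.step_eq (hA : A.Ranked r) {c : ℕ} {b : List S} {x z : X} (h : Block A r c b x z) :
    Block A r c (A.wstep b x) x z := by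
  induction h with
  | single hs h =>
    simp only [InvAutomaton.wstep, h.1]
    exact .single hs h
  | @join a u b x y x' z ha hu huo hb iha ihb =>
    rw [wstep_append, wstep_append, wout_append, ha.wout_eq, show A.wout u y = x' from huo 0]
    refine .join iha (hu.wstep hA y) (fun k => ?_) ihb
    rw [← huo (1 + k), outs_add]
    rfl

/-- Words of states act injectively on letters, so a wrong letter at the left end is still wrong at
every settled letter of the block, and each of them drops in rank. -/
theorem Block.step_ne (hA : A.Ranked r) {c : ℕ} {b : List S} {x z : X} (h : Block A r c b x z)
    {y : X} (hy : y ≠ x) : A.wout b y ≠ z ∧ Low r c (A.wstep b y) := by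
  refine ⟨fun h' => hy (A.wout_injective b (h'.trans h.wout_eq.symm)), ?_⟩
  induction h generalizing y with
  | single hs h =>
    intro s' hs'
    rw [InvAutomaton.wstep, InvAutomaton.wstep, List.mem_singleton] at hs'
    rw [hs', ← hs]
    exact h.2 y hy
  | @join a u b x y₁ x' z ha hu huo hb iha ihb =>
    rw [wstep_append, wstep_append, wout_append]
    refine ((iha hy).append (hu.wstep hA _)).append (ihb fun h' => hy ?_)
    refine A.wout_injective a (A.wout_injective u ?_)
    rw [h', ha.wout_eq]
    exact (huo 0).symm

variable (A r) in
/-- Words with at most `q` blocks of rank `c`, the rest being of lower rank. -/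
inductive Blocks (c : ℕ) : ℕ → List S → Prop
  | low {q : ℕ} {w : List S} (h : Low r c w) : Blocks c q w
  | cons {q : ℕ} {u b w : List S} {x z : X} (hu : Low r c u) (hb : Block A r c b x z)
      (hw : Blocks c q w) : Blocks c (q + 1) (u ++ b ++ w)

theorem Blocks.low_append {c q : ℕ} {u w : List S} (hu : Low r c u) (hw : Blocks A r c q w) :
    Blocks A r c q (u ++ w) := by
  cases hw with
  | low h => exact .low (hu.append h)
  | cons hu' hb hw =>
    simp only [← List.append_assoc]
    exact .cons (hu.append hu') hb hw

theorem Blocks.mono {c q q' : ℕ} (hq : q ≤ q') {w : List S} (hw : Blocks A r c q w) :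
    Blocks A r c q' w := by
  induction hw generalizing q' with
  | low h => exact .low h
  | cons hu hb _ ih =>
    obtain ⟨q', rfl⟩ : ∃ p, q' = p + 1 := ⟨q' - 1, by omega⟩
    exact .cons hu hb (ih (by omega))

theorem Blocks.append {c q q' : ℕ} {w w' : List S} (hw : Blocks A r c q w)
    (hw' : Blocks A r c q' w') : Blocks A r c (q + q') (w ++ w') := by
  induction hw with
  | low h => exact (hw'.low_append h).mono (by omega)
  | cons hu hb _ ih =>
    rw [List.append_assoc, Nat.add_right_comm]
    exact .cons hu hb ih

theorem Block.blocks {c : ℕ} {b : List S} {x z : X} (h : Block A r c b x z) :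
    Blocks A r c 1 b := by
  simpa using Blocks.cons (u := []) (w := []) (q := 0) (by simp [Low]) h (.low (by simp [Low]))

theorem Block.blocks_wstep (hA : A.Ranked r) {c : ℕ} {b : List S} {x z : X}
    (h : Block A r c b x z) (y : X) : Blocks A r c 1 (A.wstep b y) := by
  by_cases hy : y = x
  · subst hy; exact (h.step_eq hA).blocks
  · exact .low (h.step_ne hA hy).2

/-- A block that receives its letter persists, any other dissolves, and no block arises from states
of lower rank. -/
theorem Blocks.wstep (hA : A.Ranked r) {c q : ℕ} {w : List S} (hw : Blocks A r c q w) (y : X) :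
    Blocks A r c q (A.wstep w y) := by
  induction hw generalizing y with
  | low h => exact .low (h.wstep hA y)
  | cons hu hb _ ih =>
    rw [wstep_append, wstep_append, Nat.add_comm]
    exact ((hb.blocks_wstep hA _).low_append (hu.wstep hA _)).append (ih _)

theorem Blocks.run (hA : A.Ranked r) {c q : ℕ} {w : List S} (hw : Blocks A r c q w)
    (ys : ℕ → X) (k : ℕ) : Blocks A r c q (A.run w ys k) := by
  induction k with
  | zero => exact hw
  | succ k ih => exact ih.wstep hA _

/-- After one letter every state of rank `c` has dropped or is settled, hence a block by itself. -/
theorem blocks_wstep_of_low (hA : A.Ranked r) {c : ℕ} (hc : c ≠ 0) {w : List S}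
    (hw : Low r (c + 1) w) (y : X) : Blocks A r c w.length (A.wstep w y) := by
  induction w generalizing y with
  | nil => exact .low (by simp [Low, InvAutomaton.wstep])
  | cons s w ih =>
    rw [List.length_cons, Nat.add_comm]
    refine Blocks.append (w := [A.t s y]) ?_ (ih (fun a ha => hw a (List.mem_cons_of_mem _ ha)) _)
    have h1 := hw s (by simp)
    have h2 := hA.mono s y
    by_cases h3 : r (A.t s y) < c
    · exact .low (by simpa [Low] using h3)
    · obtain ⟨x, hx⟩ := hA.settled s y (by omega) (by omega)
      exact (Block.single (by omega) hx).blocks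

/-! ### Stabilisation along constant inputs -/

variable (A r) in
/-- Words of rank less than `c` and length at most `n` stabilise along constant inputs within
`p` steps. -/
def StabilizesBy (c n p : ℕ) : Prop :=
  ∀ w : List S, Low r c w → w.length ≤ n → ∀ (y : X) (k : ℕ), p ≤ k →
    A.run w (fun _ => y) k = A.run w (fun _ => y) p

theorem run_const_of_pause {w : List S} {y : X} {p k : ℕ}
    (h : A.run w (fun _ => y) (p + 1) = A.run w (fun _ => y) p) (hk : p ≤ k) :
    A.run w (fun _ => y) k = A.run w (fun _ => y) p := by
  induction k, hk using Nat.le_induction with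
  | base => rfl
  | succ k hk ih => rw [← h]; simp [run, ih]

theorem Block.run_const (hA : A.Ranked r) {c : ℕ} {b : List S} {x z : X}
    (h : Block A r c b x z) (k : ℕ) :
    Block A r c (A.run b (fun _ => x) k) x z ∧ A.outs b (fun _ => x) k = z := by
  have : Block A r c (A.run b (fun _ => x) k) x z := by
    induction k with
    | zero => exact h
    | succ k ih => exact ih.step_eq hA
  exact ⟨this, this.wout_eq⟩

/-- Settled letters stand still and every intermediate word reads a constant sequence, so all parts
stabilise in parallel and `p` does not grow with their number. -/
theorem Block.stabilizes (hA : A.Ranked r) {c n p : ℕ} (hp : StabilizesBy A r c n p)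
    {b : List S} {x z : X} (h : Block A r c b x z) (hn : b.length ≤ n) {k : ℕ} (hk : p ≤ k) :
    A.run b (fun _ => x) k = A.run b (fun _ => x) p := by
  induction h with
  | @single s x hs h =>
    have : ∀ k, A.run [s] (fun _ => x) k = [s] := by
      intro k
      induction k with
      | zero => rfl
      | succ k ih => simp [InvAutomaton.run, ih, InvAutomaton.wstep, h.1]
    rw [this, this]
  | @join a u b x y x' z ha hu huo hb iha ihb =>
    simp only [List.length_append] at hn
    have h1 : A.outs a (fun _ => x) = fun _ => y := funext fun k => (ha.run_const hA k).2
    have h2 : A.outs u (fun _ => y) = fun _ => x' := funext huo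
    have h3 : A.outs (a ++ u) (fun _ => x) = fun _ => x' := by
      funext k; rw [outs_append, h1, h2]
    simp only [run_append, h3, h1]
    rw [iha (by omega), ihb (by omega), hp u hu (by omega) y k hk]

/-! ### Fusion of neighbouring blocks -/

/-- While both blocks receive their letters, `u` reads only `y` and outputs only `x'`; once it is
stable this continues forever and the three words form one block. If a block misses its letter
earlier, it dissolves and at most the other one remains. -/
theorem Block.blocks_pair (hA : A.Ranked r) {c n p : ℕ} (hp : StabilizesBy A r c n p)
    {a u b : List S} {x y x' z : X} (ha : Block A r c a x y) (hu : Low r c u)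
    (hb : Block A r c b x' z) (hn : u.length ≤ n) (ys : ℕ → X) :
    Blocks A r c 1 (A.run (a ++ u ++ b) ys (p + 1)) := by
  -- Invariant: one block at most is left, or both have received their letters so far and `u` has
  -- moved along the constant `y`.
  have key : ∀ m, Blocks A r c 1 (A.run (a ++ u ++ b) ys m) ∨
      (∃ a' b', A.run (a ++ u ++ b) ys m = a' ++ A.run u (fun _ => y) m ++ b' ∧
        Block A r c a' x y ∧ Block A r c b' x' z ∧
        ∀ k < m, A.outs u (fun _ => y) k = x') := by
    intro m
    induction m with
    | zero => exact .inr ⟨a, b, rfl, ha, hb, by simp⟩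
    | succ m ih =>
      rcases ih with ih | ⟨a', b', hw, ha', hb', ho⟩
      · exact .inl (ih.wstep hA _)
      · have hu' := hu.run hA (fun _ => y) m
        have hs : A.run (a ++ u ++ b) ys (m + 1) = A.wstep a' (ys m) ++
            A.wstep (A.run u (fun _ => y) m) (A.wout a' (ys m)) ++
            A.wstep b' (A.wout (A.run u (fun _ => y) m) (A.wout a' (ys m))) := by
          rw [InvAutomaton.run, hw]
          simp [wstep_append]
        by_cases h1 : ys m = x
        · rw [h1, ha'.wout_eq] at hs
          by_cases h2 : A.outs u (fun _ => y) m = x'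
          · right
            refine ⟨_, _, hs, ha'.step_eq hA, ?_, fun k hk => ?_⟩
            · rw [show A.wout (A.run u (fun _ => y) m) y = x' from h2]
              exact hb'.step_eq hA
            · rcases Nat.lt_succ_iff_lt_or_eq.1 hk with hk | rfl
              exacts [ho k hk, h2]
          · left
            rw [hs]
            exact Blocks.append (q' := 0)
              (Blocks.append (q' := 0) (ha'.blocks_wstep hA x) (.low (hu'.wstep hA _)))
              (.low (hb'.step_ne hA h2).2)
        · left
          rw [hs]
          exact (hb'.blocks_wstep hA _).low_append
            ((ha'.step_ne hA h1).2.append (hu'.wstep hA _))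
  rcases key (p + 1) with h | ⟨a', b', hw, ha', hb', ho⟩
  · exact h
  · rw [hw]
    refine (Block.join ha' (hu.run hA _ _) (fun k => ?_) hb').blocks
    -- The section of `u` at time `p` is final, and its output there is among the known ones because
    -- `p + 1` steps were made.
    rw [← outs_add A u (fun _ => y) (p + 1) k, outs, hp u hu hn y _ (by omega)]
    exact ho p (by omega)

/-- Disjoint neighbouring pairs of blocks fuse simultaneously, each pair along its own input
sequence; one block may be left over. -/
theorem Blocks.halve (hA : A.Ranked r) {c n p : ℕ} (hp : StabilizesBy A r c n p) {q : ℕ}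
    {w : List S} (hw : Blocks A r c q w) (hn : w.length ≤ n) (ys : ℕ → X) :
    Blocks A r c ((q + 1) / 2) (A.run w ys (p + 1)) := by
  induction q using Nat.strong_induction_on generalizing w ys with
  | _ q ih =>
    cases hw with
    | low h => exact .low (h.run hA _ _)
    | @cons q u b w x z hu hb hw =>
      cases hw with
      | low h =>
        exact Blocks.mono (q := 1) (by omega) <| Blocks.run hA
          (Blocks.append (q' := 0) (hb.blocks.low_append hu) (.low h)) _ _
      | @cons q u₁ b₁ w x₁ z₁ hu₁ hb₁ hw =>
        simp only [List.length_append] at hn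
        have h1 := ih q (by omega) hw (by omega) (A.outs (u ++ (b ++ u₁ ++ b₁)) ys)
        have h2 := hb.blocks_pair hA hp hu₁ hb₁ (by omega) (A.outs u ys)
        have h3 := (h2.low_append (hu.run hA ys (p + 1))).append h1
        rw [← run_append, ← run_append] at h3
        rw [show (q + 1 + 1 + 1) / 2 = 1 + (q + 1) / 2 by omega]
        simpa [List.append_assoc] using h3

theorem Blocks.run_pow (hA : A.Ranked r) {c n p : ℕ} (hp : StabilizesBy A r c n p) {j : ℕ}
    {w : List S} (hw : Blocks A r c (2 ^ j) w) (hn : w.length ≤ n) (ys : ℕ → X) :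
    Blocks A r c 1 (A.run w ys ((p + 1) * j)) := by
  induction j generalizing w ys with
  | zero => exact hw
  | succ j ih =>
    rw [Nat.mul_succ, Nat.add_comm, run_add]
    refine ih ?_ (by simpa using hn) _
    have := hw.halve hA hp hn ys
    rwa [show (2 ^ (j + 1) + 1) / 2 = 2 ^ j by rw [pow_succ]; omega] at this

/-- The first letter produces at most `n < 2 ^ n.size` blocks, and `n.size` rounds of fusion leave
one. -/
theorem blocks_one_run (hA : A.Ranked r) {c n p : ℕ} (hc : c ≠ 0)
    (hp : StabilizesBy A r c n p) {w : List S} (hw : Low r (c + 1) w) (hn : w.length ≤ n)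
    (ys : ℕ → X) : Blocks A r c 1 (A.run w ys (1 + (p + 1) * n.size)) := by
  rw [run_add]
  refine Blocks.run_pow hA hp ?_ (by simpa using hn) _
  exact (blocks_wstep_of_low hA hc hw _).mono (hn.trans (Nat.lt_size_self n).le)

/-- A word with at most one block stays of this shape as long as the block receives its letter,
and is of lower rank from then on. -/
theorem low_or_block_run (hA : A.Ranked r) {c : ℕ} {u b v : List S} {x z : X} (hu : Low r c u)
    (hb : Block A r c b x z) (hv : Low r c v) (ys : ℕ → X) (m : ℕ) :
    Low r c (A.run (u ++ b ++ v) ys m) ∨ ∀ k < m, A.outs u ys k = x := by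
  induction m with
  | zero => exact .inr (by simp)
  | succ m ih =>
    rcases ih with ih | ih
    · exact .inl (ih.wstep hA _)
    · by_cases h : A.outs u ys m = x
      · refine .inr fun k hk => ?_
        rcases Nat.lt_succ_iff_lt_or_eq.1 hk with hk | rfl
        exacts [ih k hk, h]
      · left
        rw [run_append, run_append]
        refine ((hu.run hA _ _).append ?_).append (hv.run hA _ _)
        -- The block has read only `x` before time `m` and reads its first wrong letter then.
        rw [A.run_congr b (zs := fun i => if i < m then x else A.outs u ys m)]
        · rw [InvAutomaton.run, A.run_congr b (zs := fun _ => x) (by intro i hi; simp [hi])]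
          simpa using ((hb.run_const hA m).1.step_ne hA h).2
        · intro i hi
          by_cases him : i < m
          · simp [him, ih i him]
          · simp [show i = m by omega]

/-- After the fusion at most one block is left. If it dissolves within `p + 1` steps, the word of
lower rank needs `p` more. Otherwise the word before it has become stable with output `x`, so the
block and the word after it read constants forever. -/
theorem stabilizesBy_succ (hA : A.Ranked r) {c n p : ℕ} (hc : c ≠ 0)
    (hp : StabilizesBy A r c n p) :
    StabilizesBy A r (c + 1) n ((p + 1) * n.size + 2 * p + 2) := by
  intro w hw hn y k hk
  refine run_const_of_pause ?_ hk
  set j := 1 + (p + 1) * n.size with hj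
  have hB := blocks_one_run hA hc hp hw hn (fun _ => y)
  rw [← hj] at hB
  have hlen : (A.run w (fun _ => y) j).length ≤ n := by simpa using hn
  suffices h : A.run (A.run w (fun _ => y) j) (fun _ => y) (2 * p + 1 + 1) =
      A.run (A.run w (fun _ => y) j) (fun _ => y) (2 * p + 1) by
    rw [show (p + 1) * n.size + 2 * p + 2 + 1 = j + (2 * p + 1 + 1) by omega,
      show (p + 1) * n.size + 2 * p + 2 = j + (2 * p + 1) by omega, run_add,
      run_add (k := 2 * p + 1)]
    exact h
  generalize A.run w (fun _ => y) j = w' at hB hlen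
  have hlow : ∀ w', Low r c w' → w'.length ≤ n → ∀ k ≥ p,
      A.run w' (fun _ => y) (k + 1) = A.run w' (fun _ => y) k := by
    intro w' h1 h2 k hk
    rw [hp w' h1 h2 y k hk, hp w' h1 h2 y (k + 1) (by omega)]
  cases hB with
  | low h => exact hlow _ h hlen _ (by omega)
  | @cons q u b v x z hu hb hv =>
    cases hv with
    | low hv =>
      rcases low_or_block_run hA hu hb hv (fun _ => y) (p + 1) with h | h
      · have := hlow _ h (by simpa using hlen) p le_rfl
        rw [← run_add A (u ++ b ++ v) (fun _ => y) (p + 1) (p + 1),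
          ← run_add A (u ++ b ++ v) (fun _ => y) (p + 1) p] at this
        rwa [show 2 * p + 1 + 1 = p + 1 + (p + 1) by omega,
          show 2 * p + 1 = p + 1 + p by omega]
      · simp only [List.length_append] at hlen
        have h1 : A.outs u (fun _ => y) = fun _ => x := by
          funext k
          rcases lt_or_ge k (p + 1) with hk | hk
          · exact h k hk
          · rw [← h p (by omega), outs, outs, hp u hu (by omega) y k (by omega)]
        have h2 : A.outs (u ++ b) (fun _ => y) = fun _ => z := by
          funext k
          rw [outs_append, h1]
          exact (hb.run_const hA k).2
        simp only [run_append, h1, h2]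
        rw [hp u hu (by omega) y (2 * p + 1 + 1) (by omega),
          hp u hu (by omega) y (2 * p + 1) (by omega),
          hp v hv (by omega) z (2 * p + 1 + 1) (by omega),
          hp v hv (by omega) z (2 * p + 1) (by omega),
          hb.stabilizes hA hp (by omega) (k := 2 * p + 1 + 1) (by omega),
          hb.stabilizes hA hp (by omega) (k := 2 * p + 1) (by omega)]

theorem wstep_wstep_of_low_one (hA : A.Ranked r) {w : List S} (hw : Low r 1 w) (y z : X) :
    A.wstep (A.wstep w y) z = A.wstep w y := by
  induction w generalizing y z with
  | nil => rfl
  | cons s w ih =>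
    simp only [wstep]
    rw [hA.zero s y z (Nat.lt_one_iff.1 (hw s (by simp))),
      ih (fun a ha => hw a (List.mem_cons_of_mem _ ha))]

theorem stabilizesBy_one (hA : A.Ranked r) (n : ℕ) : StabilizesBy A r 1 n 1 :=
  fun _ hw _ _ _ hk => run_const_of_pause (wstep_wstep_of_low_one hA hw _ _) hk

/-- A time within which words of rank at most `c` and length at most `n` stabilise along constant
inputs. -/
def stabTime (n : ℕ) : ℕ → ℕ
  | 0 => 1
  | c + 1 => (stabTime n c + 1) * n.size + 2 * stabTime n c + 2

theorem stabilizesBy_stabTime (hA : A.Ranked r) (n c : ℕ) :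
    StabilizesBy A r (c + 1) n (stabTime n c) := by
  induction c with
  | zero => exact stabilizesBy_one hA n
  | succ c ih => exact stabilizesBy_succ hA (by omega) ih

/-! ### Pauses along arbitrary paths -/

/-- A time within which words of rank at most `c` and length at most `n` pause along every path. -/
def pauseTime (n : ℕ) : ℕ → ℕ
  | 0 => 1
  | c + 1 => (stabTime n c + 1) * n.size + stabTime n c + 2 + pauseTime n c

/-- On an arbitrary path the word `u` before the last block reads arbitrary letters, but its output
is constant while the block survives. Backwards, `u` is thus a word of the inverse automaton with
constant input and is stable after `p` steps. The block and the word after it read constants, so all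
three parts pause at time `p`. -/
theorem exists_pause (hA : A.Ranked r) (n c : ℕ) {w : List S} (hw : Low r (c + 1) w)
    (hn : w.length ≤ n) (ys : ℕ → X) :
    ∃ k ≤ pauseTime n c, A.run w ys (k + 1) = A.run w ys k := by
  induction c generalizing w ys with
  | zero => exact ⟨1, le_rfl, wstep_wstep_of_low_one hA hw _ _⟩
  | succ c ih =>
    set p := stabTime n c with hpdef
    have hp := stabilizesBy_stabTime hA n c
    have hp' := stabilizesBy_stabTime hA.inverse n c
    rw [← hpdef] at hp hp'
    set j := 1 + (p + 1) * n.size with hj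
    have hB := blocks_one_run hA (by omega) hp hw hn ys
    rw [← hj] at hB
    have hlen : (A.run w ys j).length ≤ n := by simpa using hn
    suffices h : ∃ k ≤ p + 1 + pauseTime n c, A.run (A.run w ys j) (fun i => ys (j + i)) (k + 1) =
        A.run (A.run w ys j) (fun i => ys (j + i)) k by
      obtain ⟨k, hk, h⟩ := h
      refine ⟨j + k, ?_, ?_⟩
      · simp only [pauseTime, ← hpdef]; omega
      · rw [add_assoc, run_add, run_add (k := k)]; exact h
    generalize A.run w ys j = w' at hB hlen
    generalize (fun i => ys (j + i)) = zs
    cases hB with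
    | low h =>
      obtain ⟨k, hk, h⟩ := ih h hlen zs
      exact ⟨k, by omega, h⟩
    | @cons q u b v x z hu hb hv =>
      cases hv with
      | low hv =>
        rcases low_or_block_run hA hu hb hv zs (p + 1) with h | h
        · obtain ⟨k, hk, h⟩ := ih h (by simpa using hlen) (fun i => zs (p + 1 + i))
          refine ⟨p + 1 + k, by omega, ?_⟩
          rw [add_assoc, run_add, run_add (k := k)]
          exact h
        · refine ⟨p, by omega, ?_⟩
          simp only [List.length_append] at hlen
          have hu1 : A.run u zs (p + 1) = A.run u zs p := by
            apply List.reverse_injective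
            rw [← inverse_run, ← inverse_run, run_congr _ _ (zs := fun _ => x) h,
              run_congr _ _ (zs := fun _ => x) fun i hi => h i (by omega)]
            exact hp' _ hu.reverse (by simp; omega) x _ (by omega)
          have hb1 : ∀ k ≤ p + 1, A.run b (A.outs u zs) k = A.run b (fun _ => x) k :=
            fun k hk => A.run_congr b fun i hi => h i (by omega)
          have hv1 : ∀ k ≤ p + 1, A.run v (A.outs (u ++ b) zs) k = A.run v (fun _ => z) k := by
            refine fun k hk => A.run_congr v fun i hi => ?_
            rw [outs_append, outs, hb1 i (by omega), h i (by omega)]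
            exact (hb.run_const hA i).2
          simp only [run_append]
          rw [hu1, hb1 _ le_rfl, hb1 p (by omega), hv1 _ le_rfl, hv1 p (by omega),
            hp v hv (by omega) z (p + 1) (by omega),
            hb.stabilizes hA hp (by omega) (k := p + 1) (by omega)]

/-! ### Polylogarithmic bounds for these times -/

theorem exists_stabTime_le (c : ℕ) : ∃ K, ∀ n : ℕ, stabTime n c ≤ K * (n.size + 1) ^ c := by
  induction c with
  | zero => exact ⟨1, fun n => by simp [stabTime]⟩
  | succ c ih =>
    obtain ⟨K, hK⟩ := ih
    refine ⟨2 * (K + 1), fun n => ?_⟩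
    have h := hK n
    have h1 : 1 ≤ (n.size + 1) ^ c := Nat.one_le_pow _ _ (by omega)
    have h2 : stabTime n c + 1 ≤ (K + 1) * (n.size + 1) ^ c := by nlinarith
    calc stabTime n (c + 1) ≤ (stabTime n c + 1) * (2 * (n.size + 1)) := by
          simp only [stabTime]; nlinarith [Nat.zero_le (stabTime n c * n.size)]
      _ ≤ (K + 1) * (n.size + 1) ^ c * (2 * (n.size + 1)) := Nat.mul_le_mul_right _ h2
      _ = 2 * (K + 1) * (n.size + 1) ^ (c + 1) := by ring

/-- Each step of the recursion only adds at most the stabilisation time of the same rank, so pausing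
has the same exponent as stabilising. -/
theorem exists_pauseTime_le (c : ℕ) : ∃ K, ∀ n : ℕ, pauseTime n c ≤ K * (n.size + 1) ^ c := by
  induction c with
  | zero => exact ⟨1, fun n => by simp [pauseTime]⟩
  | succ c ih =>
    obtain ⟨K, hK⟩ := ih
    obtain ⟨L, hL⟩ := exists_stabTime_le (c + 1)
    refine ⟨L + K, fun n => ?_⟩
    have h1 : pauseTime n (c + 1) ≤ stabTime n (c + 1) + pauseTime n c := by
      simp only [pauseTime, stabTime]; omega
    have h2 : (n.size + 1) ^ c ≤ (n.size + 1) ^ (c + 1) :=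
      Nat.pow_le_pow_right (by omega) (by omega)
    calc pauseTime n (c + 1) ≤ L * (n.size + 1) ^ (c + 1) + K * (n.size + 1) ^ c :=
          h1.trans (Nat.add_le_add (hL n) (hK n))
      _ ≤ L * (n.size + 1) ^ (c + 1) + K * (n.size + 1) ^ (c + 1) := by gcongr
      _ = _ := by ring

end InvAutomaton

namespace InvAutomaton

variable {S : Type u} {X : Type v} (A : InvAutomaton S X)

/-! ### Words of states acting on words of letters -/

theorem sec_append (s : S) (v w : List X) : A.sec s (v ++ w) = A.sec (A.sec s v) w := by
  induction v generalizing s with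
  | nil => rfl
  | cons x v ih => simp [sec, ih]

theorem length_out (s : S) (v : List X) : (A.out s v).length = v.length := by
  induction v generalizing s with
  | nil => rfl
  | cons x v ih => simp [out, ih]

theorem length_outInv (s : S) (v : List X) : (A.outInv s v).length = v.length := by
  induction v generalizing s with
  | nil => rfl
  | cons x v ih => simp [outInv, ih]

theorem element_nil_apply (w : List S) : A.element w [] = [] := by
  induction w with
  | nil => rfl
  | cons s w ih => exact ih

theorem element_cons_apply (w : List S) (x : X) (v : List X) :
    A.element w (x :: v) = A.wout w x :: A.element (A.wstep w x) v := by
  induction w generalizing x v with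
  | nil => rfl
  | cons s w ih => exact ih (A.o s x) (A.out (A.t s x) v)

theorem wordSec_cons (w : List S) (x : X) (v : List X) :
    A.wordSec w (x :: v) = A.wordSec (A.wstep w x) v := by
  induction w generalizing x v with
  | nil => rfl
  | cons s w ih => exact congrArg _ (ih (A.o s x) (A.out (A.t s x) v))

theorem wordSec_nil (w : List S) : A.wordSec w [] = w := by
  induction w with
  | nil => rfl
  | cons s w ih => exact congrArg _ ih

theorem length_element (w : List S) (v : List X) : (A.element w v).length = v.length := by
  induction v generalizing w with
  | nil => rw [element_nil_apply]
  | cons x v ih => simp [element_cons_apply, ih]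

theorem element_apply_append (w : List S) (v v' : List X) :
    A.element w (v ++ v') = A.element w v ++ A.element (A.wordSec w v) v' := by
  induction v generalizing w with
  | nil => simp [element_nil_apply, wordSec_nil]
  | cons x v ih => simp [element_cons_apply, ih, wordSec_cons]

theorem triv_iff_element (k : ℕ) (w : List S) :
    A.triv k w ↔ ∀ v : List X, v.length = k → A.element w v = v := by
  induction k generalizing w with
  | zero =>
    refine ⟨fun _ v hv => ?_, fun _ => trivial⟩
    rw [List.length_eq_zero_iff.1 hv, element_nil_apply]
  | succ k ih =>
    constructor
    · rintro ⟨h1, h2⟩ v hv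
      obtain ⟨x, v, rfl⟩ := List.exists_cons_of_length_eq_add_one hv
      rw [element_cons_apply, h1, (ih _).1 (h2 x) v (by simpa using hv)]
    · intro h
      have key : ∀ x (v : List X), v.length = k →
          A.wout w x = x ∧ A.element (A.wstep w x) v = v := fun x v hv => by
        simpa [element_cons_apply] using h (x :: v) (by simp [hv])
      refine ⟨fun x => (key x (List.replicate k x) (by simp)).1, fun x => (ih _).2 ?_⟩
      exact fun v hv => (key x v hv).2

theorem element_eq_one_iff (w : List S) : A.element w = 1 ↔ ∀ k, A.triv k w := by
  simp only [triv_iff_element]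
  exact ⟨fun h k v _ => by rw [h]; rfl, fun h => Equiv.ext fun v => h _ v rfl⟩

/-! ### Powers of the alphabet -/

/-- The automaton with the same states reading blocks of `m` letters at a time. -/
def power (m : ℕ) : InvAutomaton S (List.Vector X m) where
  t s v := A.sec s v.1
  o s :=
    { toFun := fun v => ⟨A.out s v.1, (A.length_out s v.1).trans v.2⟩
      invFun := fun v => ⟨A.outInv s v.1, (A.length_outInv s v.1).trans v.2⟩
      left_inv := fun v => Subtype.ext (A.outInv_out s v.1)
      right_inv := fun v => Subtype.ext (A.out_outInv s v.1) }

theorem power_wout (m : ℕ) (w : List S) (y : List.Vector X m) :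
    ((A.power m).wout w y).1 = A.element w y.1 := by
  induction w generalizing y with
  | nil => rfl
  | cons s w ih => exact ih _

theorem power_wstep (m : ℕ) (w : List S) (y : List.Vector X m) :
    (A.power m).wstep w y = A.wordSec w y.1 := by
  induction w generalizing y with
  | nil => rfl
  | cons s w ih => exact congrArg _ (ih _)

theorem power_triv (m k : ℕ) (w : List S) : (A.power m).triv k w ↔ A.triv (m * k) w := by
  induction k generalizing w with
  | zero => simp [triv]
  | succ k ih =>
    have h1 : (A.power m).triv (k + 1) w ↔ (∀ y : List.Vector X m, A.element w y.1 = y.1) ∧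
        ∀ y : List.Vector X m, A.triv (m * k) (A.wordSec w y.1) := by
      refine and_congr (forall_congr' fun y => ?_) (forall_congr' fun y => ?_)
      · rw [← power_wout]; exact Subtype.ext_iff
      · rw [ih, power_wstep]
    rw [h1]
    constructor
    · rintro ⟨h2, h3⟩
      refine (A.triv_iff_element _ _).2 fun v hv => ?_
      have hlen : (v.take m).length = m := by simp [hv, Nat.mul_succ]
      have h4 := h2 ⟨v.take m, hlen⟩
      have h5 := (A.triv_iff_element _ _).1 (h3 ⟨v.take m, hlen⟩) (v.drop m)
        (by simp [hv, Nat.mul_succ])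
      have := A.element_apply_append w (v.take m) (v.drop m)
      rw [h4, h5, List.take_append_drop] at this
      exact this
    · intro h
      have h2 : ∀ y : List.Vector X m, A.element w y.1 = y.1 := fun y =>
        (A.triv_iff_element m w).1 (A.triv_mono (by rw [Nat.mul_succ]; omega) h) y.1 y.2
      refine ⟨h2, fun y => (A.triv_iff_element _ _).2 fun v hv => ?_⟩
      have := (A.triv_iff_element _ _).1 h (y.1 ++ v)
        (by rw [List.length_append, y.2, hv, Nat.mul_succ, Nat.add_comm])
      rw [element_apply_append, h2] at this
      exact List.append_cancel_left this

/-! ### Activity -/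

open Classical in
/-- The number of words `v` of length `n` such that the section `s|_v` is not in `E`. -/
noncomputable def activity [Fintype X] (E : S → Prop) : ℕ → S → ℕ
  | 0, s => if E s then 0 else 1
  | n + 1, s => ∑ x, activity E n (A.t s x)

/-- All sections of `s` on some level are in `E`. -/
def Finitary (E : S → Prop) (s : S) : Prop := ∃ N, ∀ v : List X, v.length = N → E (A.sec s v)

variable {A} {E : S → Prop}

theorem sec_of_absorbing (hE : ∀ s x, E s → A.t s x = s) {s : S} (hs : E s) (v : List X) :
    A.sec s v = s := by
  induction v with
  | nil => rfl
  | cons x v ih => rw [sec, hE s x hs, ih]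

theorem Finitary.of_le (hE : ∀ s x, E s → A.t s x = s) {s : S} {N : ℕ}
    (h : ∀ v : List X, v.length = N → E (A.sec s v)) {v : List X} (hv : N ≤ v.length) :
    E (A.sec s v) := by
  rw [← List.take_append_drop N v, sec_append]
  have := h (v.take N) (by simp [hv])
  rwa [sec_of_absorbing hE this]

theorem finitary_of_forall [Finite X] (hE : ∀ s x, E s → A.t s x = s) {s : S}
    (h : ∀ x, A.Finitary E (A.t s x)) : A.Finitary E s := by
  cases nonempty_fintype X
  choose N hN using h
  refine ⟨(Finset.univ.sup N) + 1, fun v hv => ?_⟩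
  obtain ⟨x, v, rfl⟩ := List.exists_cons_of_length_eq_add_one hv
  refine Finitary.of_le hE (hN x) ?_
  rw [List.length_cons, Nat.add_right_cancel_iff] at hv
  rw [hv]
  exact Finset.le_sup (Finset.mem_univ x)

theorem sec_replicate_of_cycle {s : S} {c : List X} (hc : A.sec s c = s) (j : ℕ) :
    A.sec s (List.replicate j c).flatten = s := by
  induction j with
  | zero => rfl
  | succ j ih => rw [List.replicate_succ, List.flatten_cons, sec_append, hc, ih]

section Activity

variable [Fintype X]

theorem activity_mono_pred {F : S → Prop} (h : ∀ s, E s → F s) (n : ℕ) (s : S) :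
    A.activity F n s ≤ A.activity E n s := by
  classical
  induction n generalizing s with
  | zero =>
    simp only [activity]
    by_cases h1 : E s
    · simp [h1, h s h1]
    · rw [if_neg h1]; split_ifs <;> omega
  | succ n ih => exact Finset.sum_le_sum fun x _ => ih _

/-- By `hF` a state outside `E` has a section outside `E` at some letter, so every counted word has
a counted prolongation. -/
theorem activity_mono (hF : ∀ s, (∀ x, E (A.t s x)) → E s) (s : S) :
    Monotone fun n => A.activity E n s := by
  classical
  refine monotone_nat_of_le_succ fun n => ?_
  induction n generalizing s with
  | zero =>
    simp only [activity]
    by_cases h1 : E s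
    · simp [h1]
    · rw [if_neg h1]
      obtain ⟨x, hx⟩ := not_forall.1 fun h => h1 (hF s h)
      refine le_trans ?_ (Finset.single_le_sum (fun _ _ => Nat.zero_le _) (Finset.mem_univ x))
      simp [hx]
  | succ n ih => exact Finset.sum_le_sum fun x _ => ih _

theorem activity_sec_le (s : S) (v : List X) (n : ℕ) (hn : v.length ≤ n) :
    A.activity E (n - v.length) (A.sec s v) ≤ A.activity E n s := by
  induction v generalizing s n with
  | nil => exact le_rfl
  | cons x v ih =>
    obtain ⟨n, rfl⟩ : ∃ k, n = k + 1 := ⟨n - 1, by simp at hn; omega⟩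
    rw [List.length_cons, Nat.add_sub_add_right]
    exact (ih (A.t s x) n (by simpa using hn)).trans
      (Finset.single_le_sum (f := fun x => A.activity E n (A.t s x))
        (fun _ _ => Nat.zero_le _) (Finset.mem_univ x))

/-- Words extending `v` and words extending `z` are different if neither of the two is a prefix of
the other. -/
theorem activity_add_le {v z : List X} (h1 : ¬ v <+: z) (h2 : ¬ z <+: v) (s : S) (n : ℕ)
    (hv : v.length ≤ n) (hz : z.length ≤ n) :
    A.activity E (n - v.length) (A.sec s v) + A.activity E (n - z.length) (A.sec s z) ≤
      A.activity E n s := by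
  classical
  induction v generalizing s z n with
  | nil => simp at h1
  | cons x v ih =>
    cases z with
    | nil => simp at h2
    | cons y z =>
      obtain ⟨n, rfl⟩ : ∃ k, n = k + 1 := ⟨n - 1, by simp at hv; omega⟩
      rw [List.length_cons, Nat.add_sub_add_right, List.length_cons, Nat.add_sub_add_right]
      simp only [List.length_cons, Nat.add_le_add_iff_right] at hv hz
      rw [List.cons_prefix_cons] at h1 h2
      by_cases hxy : x = y
      · subst hxy
        refine (ih (by simpa using h1) (by simpa using h2) (A.t s x) n hv hz).trans ?_
        exact Finset.single_le_sum (f := fun x => A.activity E n (A.t s x))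
          (fun _ _ => Nat.zero_le _) (Finset.mem_univ x)
      · calc _ ≤ A.activity E n (A.t s x) + A.activity E n (A.t s y) :=
              Nat.add_le_add (activity_sec_le _ _ _ hv) (activity_sec_le _ _ _ hz)
          _ = ∑ i ∈ {x, y}, A.activity E n (A.t s i) := 
            (Finset.sum_pair (f := fun i => A.activity E n (A.t s i)) hxy).symm
          _ ≤ _ := Finset.sum_le_sum_of_subset (Finset.subset_univ _)

variable (A E) in
/-- The activity of `s` grows like a polynomial of degree `k - 1`; for `k = 0` it vanishes. -/
def Growth (k : ℕ) (s : S) : Prop := ∃ C, ∀ n, n * A.activity E n s ≤ C * (n + 1) ^ k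

variable (A E) in
/-- The least `k` with `Growth k s`. -/
noncomputable def rank (s : S) : ℕ := sInf {k | A.Growth E k s}

theorem Growth.t {k : ℕ} {s : S} (h : A.Growth E k s) (x : X) : A.Growth E k (A.t s x) := by
  obtain ⟨C, hC⟩ := h
  refine ⟨C * 2 ^ k, fun n => ?_⟩
  have h1 : A.activity E n (A.t s x) ≤ A.activity E (n + 1) s :=
    activity_sec_le (E := E) s [x] (n + 1) (by simp)
  calc n * A.activity E n (A.t s x) ≤ (n + 1) * A.activity E (n + 1) s :=
        Nat.mul_le_mul (by omega) h1
    _ ≤ C * (n + 1 + 1) ^ k := hC _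
    _ ≤ C * (2 * (n + 1)) ^ k := by gcongr; omega
    _ = C * 2 ^ k * (n + 1) ^ k := by rw [mul_pow]; ring

/-- The model for `hm` is a cycle of length `m` at `s` with an exit to `s'`. Every turn contributes
the activity of `s'` once more, so `n` turns bound `n` times this activity by that of `s` at depth
`n + m * n`: one degree is gained. -/
theorem Growth.drop (hF : ∀ s, (∀ x, E (A.t s x)) → E s) {k m : ℕ} {s s' : S}
    (h : A.Growth E (k + 1) s)
    (hm : ∀ n, A.activity E n s + A.activity E n s' ≤ A.activity E (n + m) s) :
    A.Growth E k s' := by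
  obtain ⟨C, hC⟩ := h
  refine ⟨2 * (C * (m + 1) ^ (k + 1)), fun n => ?_⟩
  have h1 : ∀ j, j * A.activity E n s' ≤ A.activity E (n + m * j) s := by
    intro j
    induction j with
    | zero => simp
    | succ j ih =>
      have h2 := hm (n + m * j)
      have h3 := activity_mono hF s' (show n ≤ n + m * j by omega)
      simp only at h3
      rw [Nat.mul_succ, ← add_assoc, Nat.succ_mul]
      omega
  rcases Nat.eq_zero_or_pos n with rfl | hn
  · simp
  have h2 := h1 n
  have h3 := hC (n + m * n)
  have h4 : n * (n * A.activity E n s') ≤ C * (m + 1) ^ (k + 1) * (n + 1) ^ (k + 1) := by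
    calc n * (n * A.activity E n s') ≤ (n + m * n) * A.activity E (n + m * n) s :=
          Nat.mul_le_mul (by omega) h2
      _ ≤ C * (n + m * n + 1) ^ (k + 1) := h3
      _ ≤ C * ((m + 1) * (n + 1)) ^ (k + 1) := by gcongr; nlinarith
      _ = _ := by rw [mul_pow]; ring
  have h5 : (n + 1) * (n * A.activity E n s') ≤
      (n + 1) * (2 * (C * (m + 1) ^ (k + 1)) * (n + 1) ^ k) := by
    calc (n + 1) * (n * A.activity E n s') ≤ 2 * n * (n * A.activity E n s') :=
          Nat.mul_le_mul_right _ (by omega)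
      _ = 2 * (n * (n * A.activity E n s')) := by ring
      _ ≤ 2 * (C * (m + 1) ^ (k + 1) * (n + 1) ^ (k + 1)) := Nat.mul_le_mul_left _ h4
      _ = _ := by ring
  exact Nat.le_of_mul_le_mul_left h5 (by omega)

/-- Outside `E` the activity is at least one at every depth by monotonicity, and the factor `n` in
`Growth` is unbounded. -/
theorem Growth.zero (hF : ∀ s, (∀ x, E (A.t s x)) → E s) {s : S} (h : A.Growth E 0 s) :
    E s := by
  classical
  obtain ⟨C, hC⟩ := h
  by_contra hs
  have h1 := hC (C + 1)
  have h2 := activity_mono hF s (Nat.zero_le (C + 1))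
  simp only at h2
  rw [show A.activity E 0 s = 1 by simp [activity, hs]] at h2
  simp only [pow_zero, mul_one] at h1
  nlinarith

theorem growth_rank (hg : ∀ s, ∃ k, A.Growth E k s) (s : S) : A.Growth E (A.rank E s) s := Nat.sInf_mem (hg s)

theorem rank_le {s : S} {k : ℕ} (h : A.Growth E k s) : A.rank E s ≤ k := Nat.sInf_le h

theorem rank_sec_le (hg : ∀ s, ∃ k, A.Growth E k s) (s : S) (v : List X) : A.rank E (A.sec s v) ≤ A.rank E s := by
  induction v generalizing s with
  | nil => exact le_rfl
  | cons x v ih => exact (ih _).trans (rank_le ((growth_rank hg s).t x))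

/-- Leaving a cycle lowers the rank. -/
theorem rank_sec_lt_of_cycle (hg : ∀ s, ∃ k, A.Growth E k s)
    (hF : ∀ s, (∀ x, E (A.t s x)) → E s) {s : S} {c z : List X}
    (hc : A.sec s c = s) (hz : z.length ≤ c.length) (hzc : ¬ z <+: c) (hs : A.rank E s ≠ 0) :
    A.rank E (A.sec s z) < A.rank E s := by
  obtain ⟨k, hk⟩ := Nat.exists_eq_succ_of_ne_zero hs
  rw [hk, Nat.lt_succ_iff]
  have h := growth_rank hg s
  rw [hk] at h
  refine rank_le (h.drop hF (m := c.length) fun n => ?_)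
  have hcz : ¬ c <+: z := fun h' => hzc (by rw [h'.eq_of_length_le hz])
  have h1 := activity_add_le (A := A) (E := E) hcz hzc s (n + c.length) (by omega) (by omega)
  rw [hc, Nat.add_sub_cancel] at h1
  have h2 := activity_mono hF (A.sec s z) (show n ≤ n + c.length - z.length by omega)
  simp only at h2
  omega

/-- Automata of polynomial activity become ranked automata over a power of the alphabet. -/
theorem exists_power_ranked [Finite S] (hE : ∀ s x, E s → A.t s x = s) {C d : ℕ}
    (hact : ∀ s n, A.activity E n s ≤ C * (n + 1) ^ d) :
    ∃ m, 0 < m ∧ ∃ r : S → ℕ, (A.power m).Ranked r ∧ ∀ s, r s ≤ d + 1 := by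
  classical
  cases nonempty_fintype S
  -- Activity is measured relative to `Finitary E`, because monotonicity requires a class containing
  -- each state whose sections at all letters belong to it.
  have hF : ∀ s, (∀ x, A.Finitary E (A.t s x)) → A.Finitary E s :=
    fun s h => finitary_of_forall hE h
  have hG : ∀ s, A.Growth (A.Finitary E) (d + 1) s := by
    refine fun s => ⟨C, fun n => ?_⟩
    have h1 : A.activity (A.Finitary E) n s ≤ A.activity E n s :=
      activity_mono_pred (fun s hs => ⟨0, fun v hv => by
        rw [List.length_eq_zero_iff.1 hv]; exact hs⟩) n s
    calc n * A.activity (A.Finitary E) n s ≤ (n + 1) * (C * (n + 1) ^ d) :=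
          Nat.mul_le_mul (by omega) (h1.trans (hact s n))
      _ = C * (n + 1) ^ (d + 1) := by ring
  have hg : ∀ s, ∃ k, A.Growth (A.Finitary E) k s := fun s => ⟨_, hG s⟩
  have hN : ∃ N, ∀ s, A.Finitary E s → ∀ v : List X, N ≤ v.length → E (A.sec s v) := by
    choose! N hN using fun (s : S) (hs : A.Finitary E s) => hs
    exact ⟨Finset.univ.sup N, fun s hs v hv =>
      Finitary.of_le hE (hN s hs) ((Finset.le_sup (Finset.mem_univ s)).trans hv)⟩
  obtain ⟨N, hN⟩ := hN
  -- A multiple of all possible cycle lengths, at least the depth `N` by which finitary states reach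
  -- `E`, and long enough for the pigeonhole principle.
  set m := (Fintype.card S).factorial * (N + 1) with hm
  have hm1 : N ≤ m := by nlinarith [Nat.factorial_pos (Fintype.card S)]
  have hm2 : Fintype.card S ≤ m := by nlinarith [Nat.self_le_factorial (Fintype.card S)]
  refine ⟨m, Nat.mul_pos (Nat.factorial_pos _) N.succ_pos, A.rank (A.Finitary E), ⟨fun s y => rank_sec_le hg s y.1, ?_, ?_⟩,
    fun s => rank_le (hG s)⟩
  · intro s y z hs
    have h1 := growth_rank hg s
    rw [hs] at h1
    exact sec_of_absorbing hE (hN s (h1.zero hF) y.1 (by rw [y.2]; exact hm1)) z.1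
  · rintro s ⟨y, hy⟩ hs hsy
    change A.rank (A.Finitary E) (A.sec s y) = _ at hsy
    change ∃ x, (A.power m).Settled (A.rank (A.Finitary E)) (A.sec s y) x
    -- Reading `y` visits some state `q` twice; the cycle `c` between the visits, repeated `l`
    -- times, is a loop `V` of length `m` at `q`.
    obtain ⟨i, j, hij, hq⟩ := Fintype.exists_ne_map_eq_of_card_lt
      (fun i : Fin (Fintype.card S + 1) => A.sec s (y.take i)) (by simp)
    wlog hlt : i < j generalizing i j
    · exact this j i hij.symm hq.symm (lt_of_le_of_ne (not_lt.1 hlt) hij.symm)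
    change A.sec s (y.take i) = A.sec s (y.take j) at hq
    set q := A.sec s (y.take i) with hqdef
    set c := (y.take j).drop i with hc
    have hilt : (i : ℕ) < j := hlt
    have hjm : (j : ℕ) ≤ m := by have := j.2; omega
    have hcl : c.length = j - i := by simp [hc, hy, hjm]
    have hqc : A.sec q c = q := by
      have h1 : y.take i ++ c = y.take j := by
        have := List.take_append_drop i (y.take j)
        rwa [List.take_take, min_eq_left hilt.le] at this
      rw [hqdef, ← sec_append, h1, ← hq]
    obtain ⟨l, hl⟩ : (j - i : ℕ) ∣ m :=
      (Nat.dvd_factorial (by omega) (by have := j.2; omega)).mul_right _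
    set V := (List.replicate l c).flatten with hV
    have hVl : V.length = m := by simp [hV, hcl, hl, mul_comm]
    have hqV : A.sec q V = q := sec_replicate_of_cycle hqc l
    set z := y.drop i with hz
    have hqz : A.sec q z = A.sec s y := by rw [hqdef, ← sec_append, hz, List.take_append_drop]
    have hrq : A.rank (A.Finitary E) q = A.rank (A.Finitary E) s :=
      le_antisymm (rank_sec_le hg _ _) (by
        rw [← hsy, ← hqz]; exact rank_sec_le hg _ _)
    -- Leaving the cycle would have lowered the rank, so the rest `z` of `y` follows it.
    have hzV : z <+: V := by
      by_contra h
      have := rank_sec_lt_of_cycle hg hF hqV (by simp [hVl, hz, hy]) h (by rw [hrq]; exact hs)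
      rw [hqz] at this
      omega
    -- The state reached lies on the cycle, and its looping letter is the rotation `z' ++ z` of `V =
    -- z ++ z'`.
    obtain ⟨z', hz'⟩ := hzV
    have hlen : (z' ++ z).length = m := by
      rw [List.length_append, Nat.add_comm, ← List.length_append, hz', hVl]
    have hcyc : A.sec (A.sec s y) (z' ++ z) = A.sec s y := by
      rw [← hqz, sec_append, ← sec_append A q z z', hz', hqV]
    refine ⟨⟨z' ++ z, hlen⟩, hcyc, fun x hx => ?_⟩
    refine rank_sec_lt_of_cycle hg hF hcyc (by rw [x.2, hlen]) (fun h => hx (Subtype.ext ?_))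
      (by rw [hsy]; exact hs)
    exact h.eq_of_length (by rw [x.2, hlen])

/-- In an automaton of polynomial activity, a word that is trivial on a level polylogarithmic in
its length is trivial. -/
theorem exists_triv_level [Finite S] (hE : ∀ s x, E s → A.t s x = s) {C d : ℕ}
    (hact : ∀ s n, A.activity E n s ≤ C * (n + 1) ^ d) :
    ∃ K, ∀ w : List S, A.triv (K * (w.length.size + 1) ^ (d + 1)) w → ∀ k, A.triv k w := by
  obtain ⟨m, hm, r, hr, hrd⟩ := exists_power_ranked hE hact
  obtain ⟨K, hK⟩ := exists_pauseTime_le (d + 1)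
  refine ⟨(m + 1) * (K + 1), fun w hw k => ?_⟩
  have hlow : Low r (d + 1 + 1) w := fun s _ => Nat.lt_succ_iff.2 (hrd s)
  have h1 : 1 ≤ (w.length.size + 1) ^ (d + 1) := Nat.one_le_pow _ _ (by omega)
  have h2 : (A.power m).triv (pauseTime w.length (d + 1) + 1) w := by
    refine (A.power_triv _ _ _).2 (A.triv_mono ?_ hw)
    have := hK w.length
    calc m * (pauseTime w.length (d + 1) + 1)
        ≤ (m + 1) * ((K + 1) * (w.length.size + 1) ^ (d + 1)) :=
          Nat.mul_le_mul (by omega) (by nlinarith)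
      _ = _ := by ring
  have h3 := triv_of_pause _ (fun ys => exists_pause hr w.length (d + 1) hlow le_rfl ys) h2 k
  exact A.triv_mono (Nat.le_mul_of_pos_left k hm) ((A.power_triv _ _ _).1 h3)

end Activity

end InvAutomaton

namespace InvAutomaton

variable {S : Type u} {X : Type v} (A : InvAutomaton S X)

/-! ### Contracting automata -/

theorem element_append (u w : List S) : A.element (u ++ w) = A.element w * A.element u := by
  induction u with
  | nil => simp [element]
  | cons s u ih => simp [element, ih, mul_assoc]

theorem wordSec_append_left (u w : List S) (v : List X) :
    A.wordSec (u ++ w) v = A.wordSec u v ++ A.wordSec w (A.element u v) := by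
  induction u generalizing v with
  | nil => rfl
  | cons s u ih => simp [wordSec, element, ih]

theorem wordSec_append_right (w : List S) (v v' : List X) :
    A.wordSec w (v ++ v') = A.wordSec (A.wordSec w v) v' := by
  induction v generalizing w with
  | nil => simp [wordSec_nil]
  | cons x v ih => simp [wordSec_cons, ih]

/-- The action on the extensions of `v` determines the section, so words may be replaced by shortest
representatives before taking sections. -/
theorem element_wordSec_congr {u w : List S} (h : A.element u = A.element w) (v : List X) :
    A.element (A.wordSec u v) = A.element (A.wordSec w v) := by
  ext1 v'
  have h1 := A.element_apply_append u v v'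
  have h2 := A.element_apply_append w v v'
  rw [h, h2] at h1
  exact (List.append_cancel_left h1).symm

theorem triv_congr {u w : List S} (h : A.element u = A.element w) (k : ℕ) :
    A.triv k u ↔ A.triv k w := by
  rw [triv_iff_element, triv_iff_element, h]

theorem wordLength_element_le (w : List S) : A.wordLength (A.element w) ≤ w.length :=
  Nat.sInf_le ⟨w, rfl, rfl⟩

theorem exists_length_eq_wordLength (w : List S) :
    ∃ u : List S, u.length = A.wordLength (A.element w) ∧ A.element u = A.element w :=
  Nat.sInf_mem (s := {n | ∃ u : List S, u.length = n ∧ A.element u = A.element w})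
    ⟨_, w, rfl, rfl⟩

theorem wordLength_element_append_le (u w : List S) : A.wordLength (A.element (u ++ w)) ≤
    A.wordLength (A.element u) + A.wordLength (A.element w) := by
  obtain ⟨u', hu, hu'⟩ := A.exists_length_eq_wordLength u
  obtain ⟨w', hw, hw'⟩ := A.exists_length_eq_wordLength w
  rw [element_append, ← hu', ← hw', ← element_append, hu', hw', ← hu, ← hw, ← List.length_append]
  exact A.wordLength_element_le _

/-- Sections of words of length `N` at words of length `k` have shorter representatives. -/
def Shortens (k N : ℕ) : Prop := ∀ w : List S, w.length = N → ∀ v : List X, v.length = k →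
  A.wordLength (A.element (A.wordSec w v)) < N

variable {A}

theorem length_wordSec (w : List S) (v : List X) : (A.wordSec w v).length = w.length := by
  induction w generalizing v with
  | nil => rfl
  | cons s w ih => simp [wordSec, ih]

/-- Each full piece of length `N` of the word saves at least one letter. -/
theorem Shortens.wordLength_le {k N : ℕ} (h : A.Shortens k N) (hN : 0 < N) (w : List S)
    {v : List X} (hv : v.length = k) :
    A.wordLength (A.element (A.wordSec w v)) + w.length / N ≤ w.length := by
  induction hn : w.length using Nat.strong_induction_on generalizing w v with
  | _ n ih =>
    rcases lt_or_ge n N with hlt | hge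
    · rw [Nat.div_eq_of_lt hlt, ← hn, ← length_wordSec w v]
      exact A.wordLength_element_le _
    · have h1 := h (w.take N) (by simp [hn, hge]) v hv
      have h2 := ih (n - N) (by omega) (w.drop N) (v := A.element (w.take N) v)
        (by rw [length_element, hv]) (by simp [hn])
      have h3 := A.wordLength_element_append_le (A.wordSec (w.take N) v)
        (A.wordSec (w.drop N) (A.element (w.take N) v))
      rw [← wordSec_append_left, List.take_append_drop] at h3
      have h4 : n / N = (n - N) / N + 1 := Nat.div_eq_sub_div hN hge
      omega

theorem Shortens.wordLength_sec_le {k N : ℕ} (h : A.Shortens k N) (hN : 0 < N) (w : List S)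
    {v : List X} (hv : v.length = k) :
    A.wordLength (A.element (A.wordSec w v)) + A.wordLength (A.element w) / N ≤
      A.wordLength (A.element w) := by
  obtain ⟨u, hu, hu'⟩ := A.exists_length_eq_wordLength w
  rw [← hu, ← A.element_wordSec_congr hu' v]
  exact h.wordLength_le hN u hv

/-- As long as the current length `l` exceeds `N` and half of the initial length `n`, a section at
`k` letters saves at least `l / N` letters, where `n ≤ 4 * N * (l / N)`. The second alternative sums
this over `i` rounds. -/
theorem Shortens.wordLength_mul_le {k N : ℕ} (h : A.Shortens k N) (hN : 0 < N) (w : List S)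
    (i : ℕ) {v : List X} (hv : v.length = k * i) :
    A.wordLength (A.element (A.wordSec w v)) ≤ max (A.wordLength (A.element w) / 2) N ∨
    4 * N * A.wordLength (A.element (A.wordSec w v)) + i * A.wordLength (A.element w) ≤
      4 * N * A.wordLength (A.element w) := by
  induction i generalizing v with
  | zero =>
    right
    rw [List.length_eq_zero_iff.1 hv, wordSec_nil]
    simp
  | succ i ih =>
    rw [← List.take_append_drop (k * i) v, wordSec_append_right]
    have h1 := ih (v := v.take (k * i)) (by simp [hv, Nat.mul_succ])
    have h2 := h.wordLength_sec_le hN (A.wordSec w (v.take (k * i)))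
      (v := v.drop (k * i)) (by simp [hv, Nat.mul_succ])
    generalize A.wordLength (A.element (A.wordSec w (v.take (k * i)))) = l at h1 h2
    generalize A.wordLength (A.element (A.wordSec (A.wordSec w (v.take (k * i)))
      (v.drop (k * i)))) = l' at h2
    generalize A.wordLength (A.element w) = n at h1
    by_cases h3 : l ≤ max (n / 2) N
    · exact .inl (le_trans (Nat.le_of_add_right_le h2) h3)
    · right
      have h4 := h1.resolve_left h3
      have h5 : 1 ≤ l / N := (Nat.one_le_div_iff hN).2 (by omega)
      have h6 := Nat.lt_mul_div_succ l hN
      have h7 : n ≤ 4 * N * (l / N) := by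
        have : N * (l / N + 1) ≤ 2 * (N * (l / N)) := by nlinarith
        have : n ≤ 2 * l := by omega
        nlinarith
      have h8 : 4 * N * (l' + l / N) ≤ 4 * N * l := Nat.mul_le_mul_left _ h2
      nlinarith

/-- For `i = 4 * N` the second alternative of `wordLength_mul_le` forces length zero, so `k * (4 *
N)` letters halve the length or bring it to at most `N`. -/
theorem Shortens.wordLength_le_of_size {k N : ℕ} (h : A.Shortens k N) (hN : 0 < N) (j : ℕ)
    (w : List S) (hw : A.wordLength (A.element w) < 2 ^ j ∨ A.wordLength (A.element w) ≤ N)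
    {v : List X} (hv : v.length = k * (4 * N) * j) :
    A.wordLength (A.element (A.wordSec w v)) ≤ N := by
  induction j generalizing w v with
  | zero =>
    rw [List.length_eq_zero_iff.1 hv, wordSec_nil]
    simp only [pow_zero] at hw
    omega
  | succ j ih =>
    have hv' : v.length = k * (4 * N) * j + k * (4 * N) := by rw [hv]; ring
    rw [← List.take_append_drop (k * (4 * N)) v, wordSec_append_right]
    refine ih _ ?_ (by simp [hv'])
    rcases h.wordLength_mul_le hN w (4 * N) (v := v.take (k * (4 * N))) (by simp [hv']) with h1 | h1
    · rw [pow_succ] at hw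
      omega
    · have : 4 * N * A.wordLength (A.element (A.wordSec w (v.take (k * (4 * N))))) ≤ 0 := by omega
      have : A.wordLength (A.element (A.wordSec w (v.take (k * (4 * N))))) = 0 := by
        rcases Nat.mul_eq_zero.1 (Nat.le_zero.1 this) with h | h <;> omega
      omega

/-- In a contracting automaton, a word that is trivial on a level logarithmic in its length is
trivial. -/
theorem Shortens.exists_triv_level [Finite S] {k N : ℕ} (h : A.Shortens k N) (hN : 0 < N) :
    ∃ K, ∀ w : List S, A.triv (K * (w.length.size + 1)) w → ∀ k, A.triv k w := by
  classical
  -- There are finitely many words of length at most `N`, so one level `L` reveals all the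
  -- nontrivial ones.
  have hL : ∃ L, ∀ u : List S, u.length ≤ N → A.triv L u → ∀ k, A.triv k u := by
    have hu : ∀ u : List S, ∃ L, A.triv L u → ∀ k, A.triv k u := by
      intro u
      by_cases hu : ∀ k, A.triv k u
      · exact ⟨0, fun _ => hu⟩
      · obtain ⟨k, hk⟩ := not_forall.1 hu
        exact ⟨k, fun h => (hk h).elim⟩
    choose L hL using hu
    have hfin : {u : List S | u.length ≤ N}.Finite := List.finite_length_le S N
    refine ⟨hfin.toFinset.sup L, fun u hu hut => hL u (A.triv_mono ?_ hut)⟩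
    exact Finset.le_sup (f := L) (by simpa using hu)
  obtain ⟨L, hL⟩ := hL
  refine ⟨k * (4 * N) + L, fun w hw => ?_⟩
  set M := k * (4 * N) * w.length.size with hM
  have h1 : A.triv (M + L) w := A.triv_mono (by rw [hM]; nlinarith) hw
  rw [triv_iff_element] at h1
  -- The sections on level `M` have representatives of length at most `N`, and triviality of `w` on
  -- level `M + L` makes them trivial on level `L`.
  have h2 : ∀ v : List X, v.length = M → A.element (A.wordSec w v) = 1 := by
    intro v hv
    have h3 := h.wordLength_le_of_size hN w.length.size w
      (.inl ((A.wordLength_element_le w).trans_lt (Nat.lt_size_self _))) hv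
    obtain ⟨u, hu, hu'⟩ := A.exists_length_eq_wordLength (A.wordSec w v)
    rw [← hu', element_eq_one_iff]
    refine hL u (by omega) ((A.triv_congr hu' L).2 ((A.triv_iff_element _ _).2 fun v' hv' => ?_))
    have h4 := h1 (v ++ v') (by simp [hv, hv'])
    rw [element_apply_append] at h4
    exact (List.append_inj h4 (length_element ..)).2
  intro j
  refine A.triv_mono (Nat.le_add_left j (M + L)) ((A.triv_iff_element _ _).2 fun v hv => ?_)
  obtain ⟨v₁, v₂, v₃, rfl, hv₁, hv₂⟩ : ∃ v₁ v₂ v₃ : List X, v = v₁ ++ v₂ ++ v₃ ∧ v₁.length = M ∧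
      v₂.length = L := by
    refine ⟨v.take M, (v.drop M).take L, (v.drop M).drop L, ?_, ?_, ?_⟩
    · rw [List.append_assoc, List.take_append_drop, List.take_append_drop]
    · simp [hv, add_assoc]
    · simp [hv, add_assoc]
  have h4 := h1 (v₁ ++ v₂) (by simp [hv₁, hv₂])
  have h5 : A.element (A.wordSec w (v₁ ++ v₂)) = 1 := by
    rw [wordSec_append_right]
    have h6 := A.element_wordSec_congr (u := A.wordSec w v₁) (w := []) (h2 v₁ hv₁) v₂
    rw [h6]
    rfl
  rw [element_apply_append, h4, h5]
  rfl

/-! ### The symmetrization -/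

theorem symmetrization_act_inl (s : S) : A.symmetrization.act (Sum.inl s) = A.act s := by
  ext1 v
  change A.symmetrization.out (Sum.inl s) v = A.out s v
  induction v generalizing s with
  | nil => rfl
  | cons x v ih => exact congrArg _ (ih (A.t s x))

theorem symmetrization_act_inr (s : S) : A.symmetrization.act (Sum.inr s) = (A.act s)⁻¹ := by
  ext1 v
  change A.symmetrization.out (Sum.inr s) v = A.outInv s v
  induction v generalizing s with
  | nil => rfl
  | cons x v ih => exact congrArg _ (ih _)

theorem exists_element_eq {g : Equiv.Perm (List X)} (hg : g ∈ A.group) :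
    ∃ w : List (S ⊕ S), A.symmetrization.element w = g := by
  unfold group at hg
  induction hg using Subgroup.closure_induction'' with
  | mem g hg =>
    obtain ⟨s, rfl⟩ := hg
    exact ⟨[Sum.inl s], by simp [element, symmetrization_act_inl]⟩
  | inv_mem g hg =>
    obtain ⟨s, rfl⟩ := hg
    exact ⟨[Sum.inr s], by simp [element, symmetrization_act_inr]⟩
  | one => exact ⟨[], rfl⟩
  | mul g h _ _ hg hh =>
    obtain ⟨u, rfl⟩ := hg
    obtain ⟨w, rfl⟩ := hh
    exact ⟨w ++ u, element_append ..⟩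

theorem o_eq_one_of_act_eq_one {e : S} (he : A.act e = 1) : A.o e = 1 := by
  ext1 x
  have : A.out e [x] = [x] := congrArg (fun f : Equiv.Perm (List X) => f [x]) he
  simpa [out] using this

/-- Sections of a trivial state act trivially, and minimality leaves only one such state. -/
theorem IsMinimal.t_eq (hmin : A.IsMinimal) {e : S} (he : A.act e = 1) (x : X) :
    A.t e x = e := by
  refine hmin ?_
  rw [he]
  ext1 v
  have : A.out e (x :: v) = x :: v := congrArg (fun f : Equiv.Perm (List X) => f (x :: v)) he
  exact (List.cons.inj this).2

/-- The sections of an inverse state are the inverses of the sections of the state, at letters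
permuted by `o s`. -/
theorem activity_symmetrization [Fintype X] (e : S) (n : ℕ) (s : S) :
    A.symmetrization.activity (fun s => s = Sum.inl e ∨ s = Sum.inr e) n (Sum.inl s) =
      A.activity (· = e) n s ∧
    A.symmetrization.activity (fun s => s = Sum.inl e ∨ s = Sum.inr e) n (Sum.inr s) =
      A.activity (· = e) n s := by
  induction n generalizing s with
  | zero => by_cases h : s = e <;> simp [activity, h]
  | succ n ih =>
    refine ⟨Finset.sum_congr rfl fun x _ => (ih _).1, ?_⟩
    refine (Finset.sum_congr rfl fun x _ => (ih _).2).trans ?_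
    exact Equiv.sum_comp (A.o s).symm fun x => A.activity (· = e) n (A.t s x)

theorem activity_eq_ncard [Fintype X] (e : S) (n : ℕ) (s : S) :
    A.activity (· = e) n s = {v : List X | v.length = n ∧ A.sec s v ≠ e}.ncard := by
  classical
  induction n generalizing s with
  | zero =>
    by_cases h : s = e
    · have : {v : List X | v.length = 0 ∧ A.sec s v ≠ e} = ∅ := by
        ext v; simp only [List.length_eq_zero_iff]; constructor
        · rintro ⟨rfl, h'⟩; exact h' h
        · exact False.elim
      rw [this]
      simp [activity, h]
    · have : {v : List X | v.length = 0 ∧ A.sec s v ≠ e} = {[]} := by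
        ext v; simp only [List.length_eq_zero_iff]; constructor
        · exact fun h => h.1
        · rintro rfl; exact ⟨rfl, h⟩
      rw [this]
      simp [activity, h]
  | succ n ih =>
    simp only [activity, ih, ← Nat.card_coe_set_eq]
    have : ∀ x, Finite {v : List X | v.length = n ∧ A.sec (A.t s x) v ≠ e} := fun x =>
      ((List.finite_length_eq X n).subset fun v hv => hv.1).to_subtype
    rw [← Nat.card_sigma]
    refine Nat.card_congr
      { toFun := fun p => ⟨p.1 :: p.2.1, by simp [p.2.2.1], p.2.2.2⟩
        invFun := fun v => match v with
          | ⟨[], h⟩ => absurd h.1 (by simp)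
          | ⟨x :: v, h⟩ => ⟨x, v, by simpa using h.1, h.2⟩
        left_inv := fun p => rfl
        right_inv := ?_ }
    rintro ⟨_ | ⟨x, v⟩, h⟩
    · exact absurd h.1 (by simp)
    · rfl

theorem exists_eval_le (P : Polynomial ℝ) :
    ∃ C : ℕ, ∀ n : ℕ, P.eval (n : ℝ) ≤ C * ((n : ℝ) + 1) ^ P.natDegree := by
  obtain ⟨C, hC⟩ := exists_nat_ge (∑ i ∈ Finset.range (P.natDegree + 1), |P.coeff i|)
  refine ⟨C, fun n => ?_⟩
  rw [Polynomial.eval_eq_sum_range]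
  refine le_trans ?_ (mul_le_mul_of_nonneg_right hC (by positivity))
  rw [Finset.sum_mul]
  refine Finset.sum_le_sum fun i hi => ?_
  have h1 : (n : ℝ) ^ i ≤ ((n : ℝ) + 1) ^ P.natDegree := by
    have h2 : (1 : ℝ) ≤ (n : ℝ) + 1 := by have := Nat.cast_nonneg (α := ℝ) n; linarith
    calc (n : ℝ) ^ i ≤ ((n : ℝ) + 1) ^ i := by gcongr; linarith
      _ ≤ _ := pow_le_pow_right₀ h2 (by simpa [Nat.lt_succ_iff] using hi)
  calc P.coeff i * (n : ℝ) ^ i ≤ |P.coeff i| * (n : ℝ) ^ i :=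
        mul_le_mul_of_nonneg_right (le_abs_self _) (by positivity)
    _ ≤ _ := mul_le_mul_of_nonneg_left h1 (abs_nonneg _)

theorem IsPolynomialOfDegree.exists_activity_le [Fintype X] {e : S} {d : ℕ}
    (hd : A.IsPolynomialOfDegree e d) : ∃ C, ∀ s n,
      A.symmetrization.activity (fun s => s = Sum.inl e ∨ s = Sum.inr e) n s ≤
        C * (n + 1) ^ d := by
  obtain ⟨P, rfl, hP⟩ := hd.1
  obtain ⟨C, hC⟩ := exists_eval_le P
  have key : ∀ s n, A.activity (· = e) n s ≤ C * (n + 1) ^ P.natDegree := by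
    intro s n
    rw [activity_eq_ncard]
    exact_mod_cast (hP s n).trans (hC n)
  refine ⟨C, fun s n => ?_⟩
  rcases s with s | s
  · rw [(activity_symmetrization e n s).1]; exact key s n
  · rw [(activity_symmetrization e n s).2]; exact key s n

end InvAutomaton

/-! ### Stack machines -/

/-- An operation on a stack. -/
inductive StackOp (Γ : Type) where
  | keep
  | pop
  | push (a : Γ)

namespace StackOp

variable {Γ : Type}

/-- The effect of an operation on a stack; the top of a stack is the head of the list. -/
def apply : StackOp Γ → List Γ → List Γ
  | keep, l => l
  | pop, l => l.tail
  | push a, l => a :: l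

instance [Finite Γ] : Finite (StackOp Γ) := by
  refine Finite.of_surjective (fun x : Option (Option Γ) => match x with
    | none => keep
    | some none => pop
    | some (some a) => push a) ?_
  rintro (_ | _ | a)
  exacts [⟨none, rfl⟩, ⟨some none, rfl⟩, ⟨some (some a), rfl⟩]

end StackOp

/-- A finite-state machine working on stacks indexed by `ι`. In each step it sees the tops of all
stacks; the next state `none` means that it stops. -/
structure StackMachine (ι Γ : Type) where
  Q : Type
  [finQ : Finite Q]
  start : Q
  δ : Q → (ι → Option Γ) → Option Q × (ι → StackOp Γ)

namespace StackMachine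

variable {ι Γ : Type}

instance (M : StackMachine ι Γ) : Finite M.Q := M.finQ

/-- The tops of the stacks. -/
def tops (σ : ι → List Γ) (i : ι) : Option Γ := (σ i).head?

/-- The stacks after one operation on each of them. -/
def applyOps (ops : ι → StackOp Γ) (σ : ι → List Γ) (i : ι) : List Γ := (ops i).apply (σ i)

/-- `M.RunsFrom q σ t σ'`: from the state `q` and the stacks `σ` the machine stops after `t` steps
with stacks `σ'`. -/
inductive RunsFrom (M : StackMachine ι Γ) : M.Q → (ι → List Γ) → ℕ → (ι → List Γ) → Prop
  | exit {q : M.Q} {σ : ι → List Γ} {ops : ι → StackOp Γ} (h : M.δ q (tops σ) = (none, ops)) :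
      RunsFrom M q σ 1 (applyOps ops σ)
  | step {q q' : M.Q} {σ σ' : ι → List Γ} {t : ℕ} {ops : ι → StackOp Γ}
      (h : M.δ q (tops σ) = (some q', ops)) (hr : RunsFrom M q' (applyOps ops σ) t σ') :
      RunsFrom M q σ (t + 1) σ'

/-- Started on the stacks `σ`, the machine stops within `B` steps with stacks `σ'`. -/
def Runs (M : StackMachine ι Γ) (σ : ι → List Γ) (B : ℕ) (σ' : ι → List Γ) : Prop :=
  ∃ t ≤ B, M.RunsFrom M.start σ t σ'

theorem Runs.mono {M : StackMachine ι Γ} {σ σ' : ι → List Γ} {B B' : ℕ} (h : M.Runs σ B σ')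
    (hB : B ≤ B') : M.Runs σ B' σ' := by
  obtain ⟨t, ht, h⟩ := h
  exact ⟨t, ht.trans hB, h⟩

/-- Run `M`, then `N`. -/
def seq (M N : StackMachine ι Γ) : StackMachine ι Γ where
  Q := M.Q ⊕ N.Q
  start := Sum.inl M.start
  δ
    | Sum.inl q, τ => (some (((M.δ q τ).1.map Sum.inl).getD (Sum.inr N.start)), (M.δ q τ).2)
    | Sum.inr q, τ => ((N.δ q τ).1.map Sum.inr, (N.δ q τ).2)

theorem Runs.seq {M N : StackMachine ι Γ} {σ σ' σ'' : ι → List Γ} {a b : ℕ}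
    (hM : M.Runs σ a σ') (hN : N.Runs σ' b σ'') : (M.seq N).Runs σ (a + b) σ'' := by
  obtain ⟨t, ht, hM⟩ := hM
  obtain ⟨t', ht', hN⟩ := hN
  refine ⟨t + t', by omega, ?_⟩
  have h1 : (M.seq N).RunsFrom (Sum.inr N.start) σ' t' σ'' := by
    clear ht ht' hM
    generalize N.start = q at hN
    induction hN with
    | exit h => exact .exit (by simp only [StackMachine.seq, h]; rfl)
    | step h _ ih => exact .step (by simp only [StackMachine.seq, h]; rfl) ih
  change (M.seq N).RunsFrom (Sum.inl M.start) σ (t + t') σ''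
  clear hN ht ht'
  generalize M.start = q at hM
  induction hM with
  | exit h =>
    rw [Nat.add_comm]
    exact .step (by simp only [StackMachine.seq, h]; rfl) h1
  | @step q q' σ σ' t ops h _ ih =>
    rw [Nat.add_right_comm]
    exact .step (by simp only [StackMachine.seq, h]; rfl) (ih h1)

/-- Run `M` as long as the stack `i` is not empty. -/
def loop (i : ι) (M : StackMachine ι Γ) : StackMachine ι Γ where
  Q := Option M.Q
  start := none
  δ
    | none, τ => ((τ i).map fun _ => some M.start, fun _ => .keep)
    | some q, τ => (some (M.δ q τ).1, (M.δ q τ).2)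

theorem runs_loop_nil {i : ι} (M : StackMachine ι Γ) {σ : ι → List Γ} (h : σ i = []) :
    (M.loop i).Runs σ 1 σ := by
  refine ⟨1, le_rfl, ?_⟩
  exact .exit (ops := fun _ => .keep) (by simp [loop, tops, h])

theorem runs_loop_cons {i : ι} {M : StackMachine ι Γ} {σ σ' σ'' : ι → List Γ} {a b : ℕ}
    (h : σ i ≠ []) (hM : M.Runs σ a σ') (hl : (M.loop i).Runs σ' b σ'') :
    (M.loop i).Runs σ (1 + a + b) σ'' := by
  obtain ⟨t, ht, hM⟩ := hM
  obtain ⟨t', ht', hl⟩ := hl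
  refine ⟨t + t' + 1, by omega, ?_⟩
  obtain ⟨x, l, hx⟩ := List.exists_cons_of_ne_nil h
  refine .step (q' := some M.start) (ops := fun _ => .keep) (by simp [loop, tops, hx]) ?_
  change (M.loop i).RunsFrom (some M.start) σ (t + t') σ''
  generalize M.start = q at hM
  clear hx h ht ht'
  induction hM with
  | exit h =>
    rw [Nat.add_comm]
    exact .step (by simp only [loop, h]) hl
  | step h _ ih =>
    rw [Nat.add_right_comm]
    exact .step (by simp only [loop, h]) (ih hl)

/-! ### Simulation by Turing machines -/

section Tape

open Turing

theorem listBlank_cons_default_nil :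
    (ListBlank.mk ([] : List (Option Γ))).cons default = ListBlank.mk [] := by
  rw [ListBlank.cons_mk]
  exact Quotient.sound' (.inr ⟨1, rfl⟩)

theorem head_mk₁_map (l : List Γ) : (Tape.mk₁ (l.map some)).head = l.head? := by
  cases l <;> rfl

/-- A tape that is blank left of its head serves as a stack with its top under the head; a popped
cell is blanked before the head leaves it. -/
theorem mk₁_write_move_right (l : List Γ) :
    ((Tape.mk₁ (l.map some)).write none).move Dir.right = Tape.mk₁ (l.tail.map some) := by
  have h : ∀ R : ListBlank (Option Γ),
      ((Tape.mk' (ListBlank.mk []) R).write none).move Dir.right =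
        Tape.mk' (ListBlank.mk []) R.tail := by
    intro R
    rw [Tape.write_mk', Tape.move_right_mk', ListBlank.head_cons, ListBlank.tail_cons]
    exact congrArg (Tape.mk' · R.tail) listBlank_cons_default_nil
  refine (h _).trans ?_
  rw [ListBlank.tail_mk, ← List.map_tail]
  rfl

/-- A Turing machine writes before it moves, so a push takes two steps; this is why the simulation
is slower by a factor of two. -/
theorem mk₁_move_left_write (l : List Γ) (a : Γ) :
    (((Tape.mk₁ (l.map some)).write (Tape.mk₁ (l.map some)).head).move Dir.left).write (some a) =
      Tape.mk₁ ((a :: l).map some) := by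
  rw [Tape.write_self]
  change ((Tape.mk' (ListBlank.mk []) (ListBlank.mk (l.map some))).move Dir.left).write (some a) = _
  rw [Tape.move_left_mk', Tape.write_mk', ListBlank.tail_cons, ListBlank.tail_mk,
    ListBlank.cons_mk]
  rfl

end Tape

section Simulation

variable {α : Type u} {n : ℕ} (M : StackMachine ι Γ) [Finite ι] [Finite Γ]

open Classical in
/-- The Turing machine that simulates the stack machine `M` with two steps for each of its steps,
and then accepts if the stack `out` is empty. -/
noncomputable def toTM (eqv : ι ≃ Fin (n + 1)) (out : ι) (f : α → Γ)
    (hf : Function.Injective f) : MultiTapeTM α where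
  extra := n
  Γ := Option Γ
  letter a := some (f a)
  letter_injective a b h := hf (Option.some_injective _ h)
  letter_ne_blank a := Option.some_ne_none _
  Q := Option M.Q ⊕ (Option M.Q × (ι → StackOp Γ)) ⊕ Bool
  start := Sum.inl (some M.start)
  accept := Sum.inr (Sum.inr true)
  reject := Sum.inr (Sum.inr false)
  accept_ne_reject := by simp
  δ
    | Sum.inl (some q), τ =>
      (Sum.inr (Sum.inl (M.δ q fun i => τ (eqv i))), fun j =>
        match (M.δ q fun i => τ (eqv i)).2 (eqv.symm j) with
        | .keep => (τ j, none)
        | .pop => (none, some .right)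
        | .push _ => (τ j, some .left))
    | Sum.inl none, τ => (Sum.inr (Sum.inr (decide (τ (eqv out) = none))), fun j => (τ j, none))
    | Sum.inr (Sum.inl (q, ops)), τ =>
      (Sum.inl q, fun j =>
        match ops (eqv.symm j) with
        | .push a => (some a, none)
        | _ => (τ j, none))
    | Sum.inr (Sum.inr b), τ => (Sum.inr (Sum.inr b), fun j => (τ j, none))

variable (eqv : ι ≃ Fin (n + 1)) (out : ι) (f : α → Γ) (hf : Function.Injective f)

/-- The configuration of the simulating Turing machine. -/
noncomputable def toCfg (q : Option M.Q) (σ : ι → List Γ) : (M.toTM eqv out f hf).Cfg where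
  state := Sum.inl q
  tape j := Turing.Tape.mk₁ ((σ (eqv.symm j)).map some)

theorem step_step_toCfg (q : M.Q) (σ : ι → List Γ) :
    (M.toTM eqv out f hf).step ((M.toTM eqv out f hf).step (M.toCfg eqv out f hf (some q) σ)) =
      M.toCfg eqv out f hf (M.δ q (tops σ)).1 (applyOps (M.δ q (tops σ)).2 σ) := by
  have htops : (fun i => ((M.toCfg eqv out f hf (some q) σ).tape (eqv i)).head) = tops σ := by
    funext i
    simp only [toCfg, tops, Equiv.symm_apply_apply]
    exact head_mk₁_map _
  have h1 : (M.toTM eqv out f hf).step (M.toCfg eqv out f hf (some q) σ) =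
      { state := Sum.inr (Sum.inl (M.δ q (tops σ)))
        tape := fun j => (M.toTM eqv out f hf).updateTape
          ((M.toCfg eqv out f hf (some q) σ).tape j)
          (match (M.δ q (tops σ)).2 (eqv.symm j) with
            | .keep => (((M.toCfg eqv out f hf (some q) σ).tape j).head, none)
            | .pop => (none, some .right)
            | .push _ => (((M.toCfg eqv out f hf (some q) σ).tape j).head, some .left)) } := by
    rw [MultiTapeTM.step, if_neg (by simp [toCfg, toTM]), ← htops]
    rfl
  rw [h1]
  generalize M.δ q (tops σ) = r
  obtain ⟨q', ops⟩ := r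
  rw [MultiTapeTM.step, if_neg (by simp [toTM])]
  simp only [toCfg, toTM]
  congr 1
  funext j
  simp only [applyOps]
  cases ops (eqv.symm j) with
  | keep => exact (Turing.Tape.write_self _).trans (Turing.Tape.write_self _)
  | pop => exact (Turing.Tape.write_self _).trans (mk₁_write_move_right _)
  | push a => exact mk₁_move_left_write _ a

theorem iterate_toCfg {q : M.Q} {σ σ' : ι → List Γ} {t : ℕ} (h : M.RunsFrom q σ t σ') :
    (M.toTM eqv out f hf).step^[2 * t] (M.toCfg eqv out f hf (some q) σ) =
      M.toCfg eqv out f hf none σ' := by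
  induction h with
  | exit h =>
    refine (step_step_toCfg ..).trans ?_
    rw [h]
  | @step q q' σ σ' t ops h _ ih =>
    rw [show 2 * (t + 1) = 2 * t + 1 + 1 by ring, Function.iterate_succ_apply,
      Function.iterate_succ_apply, step_step_toCfg, h]
    exact ih

end Simulation

/-- A stack machine that empties or fills the stack `out` according to membership in `L` yields a
Turing machine that decides `L`. -/
theorem exists_decidesInTime [Finite ι] [Finite Γ] [DecidableEq ι] {α : Type u}
    (M : StackMachine ι Γ) (inp out : ι) (f : α → Γ) (hf : Function.Injective f)
    (L : Language α) (B : ℕ → ℕ)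
    (h : ∀ w : List α, ∃ σ', M.Runs (Function.update (fun _ => []) inp (w.map f)) (B w.length) σ' ∧
      (σ' out = [] ↔ w ∈ L)) :
    ∃ N : MultiTapeTM α, N.DecidesInTime L fun n => 2 * B n + 1 := by
  classical
  obtain ⟨k, ⟨e⟩⟩ := Finite.exists_equiv_fin ι
  obtain ⟨n, rfl⟩ : ∃ n, k = n + 1 := ⟨k - 1, by have := (e inp).2; omega⟩
  -- The input stack has to become tape `0`.
  set eqv : ι ≃ Fin (n + 1) := e.trans (Equiv.swap (e inp) 0) with heqv
  have hinp : eqv inp = 0 := by simp [heqv]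
  refine ⟨M.toTM eqv out f hf, fun w => ?_⟩
  obtain ⟨σ', ⟨t, ht, hr⟩, hL⟩ := h w
  have hinit : (M.toTM eqv out f hf).init w = M.toCfg eqv out f hf (some M.start)
      (Function.update (fun _ => []) inp (w.map f)) := by
    simp only [MultiTapeTM.init, toCfg]
    congr 1
    funext j
    change Fin (n + 1) at j
    by_cases hj : j = 0
    · have h0 : eqv.symm j = inp := by rw [hj, ← hinp, Equiv.symm_apply_apply]
      refine (if_pos hj).trans ?_
      rw [h0, Function.update_self]
      exact congrArg (Turing.Tape.mk₁ (Γ := Option Γ)) 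
        (List.map_map (f := f) (g := some) (l := w)).symm
    · have : eqv.symm j ≠ inp := fun h =>
        hj (by rw [← hinp, ← h]; exact (eqv.apply_symm_apply j).symm)
      refine (if_neg hj).trans ?_
      rw [Function.update_of_ne this]
      rfl
  have hlast : ((M.toTM eqv out f hf).step^[2 * t + 1] ((M.toTM eqv out f hf).init w)).state =
      Sum.inr (Sum.inr (decide (σ' out = []))) := by
    rw [Function.iterate_succ_apply', hinit, iterate_toCfg M eqv out f hf hr, MultiTapeTM.step,
      if_neg (by simp [toCfg, toTM])]
    simp only [toCfg, toTM, Equiv.symm_apply_apply]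
    congr 3
    refine propext (Iff.trans (iff_of_eq (congrArg (· = none) ?_)) List.head?_eq_none_iff)
    exact head_mk₁_map _
  refine ⟨2 * t + 1, by simpa using ht, fun hw => ?_, fun hw => ?_⟩
  · rw [hlast, decide_eq_true (hL.2 hw)]; rfl
  · rw [hlast, decide_eq_false (fun h => hw (hL.1 h))]; rfl

end StackMachine

/-! ### The memory of the word problem machine -/

/-- Names of the stacks. -/
inductive WPStack (X : Type) (D : ℕ) where
  | inp
  | work
  | flag
  | clock
  | half
  | out (x : X)
  | cnt (j : Fin D)
  | spare (j : Fin D)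

/-- Stack symbols: input letters, states (with a mark for the first letter of a word), tally
marks. -/
inductive WPSymbol (I S : Type) where
  | inp (a : I)
  | letter (s : S) (first : Bool)
  | mark

instance {X : Type} [Finite X] {D : ℕ} : Finite (WPStack X D) := by
  refine Finite.of_surjective (fun x : Fin 5 ⊕ X ⊕ Fin D ⊕ Fin D => match x with
    | .inl 0 => .inp
    | .inl 1 => .work
    | .inl 2 => .flag
    | .inl 3 => .clock
    | .inl 4 => .half
    | .inr (.inl x) => .out x
    | .inr (.inr (.inl j)) => .cnt j
    | .inr (.inr (.inr j)) => .spare j) ?_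
  rintro (_ | _ | _ | _ | _ | x | j | j)
  exacts [⟨.inl 0, rfl⟩, ⟨.inl 1, rfl⟩, ⟨.inl 2, rfl⟩, ⟨.inl 3, rfl⟩, ⟨.inl 4, rfl⟩,
    ⟨.inr (.inl x), rfl⟩, ⟨.inr (.inr (.inl j)), rfl⟩, ⟨.inr (.inr (.inr j)), rfl⟩]

instance {I S : Type} [Finite I] [Finite S] : Finite (WPSymbol I S) := by
  refine Finite.of_surjective (fun x : Option (I ⊕ (S × Bool)) => match x with
    | none => .mark
    | some (.inl a) => .inp a
    | some (.inr (s, b)) => .letter s b) ?_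
  rintro (a | ⟨s, b⟩ | _)
  exacts [⟨some (.inl a), rfl⟩, ⟨some (.inr (s, b)), rfl⟩, ⟨none, rfl⟩]

/-- The contents of all stacks. -/
@[ext] structure WPMemory (I S X : Type) (D : ℕ) where
  inp : List (WPSymbol I S)
  work : List (WPSymbol I S)
  flag : List (WPSymbol I S)
  clock : List (WPSymbol I S)
  half : List (WPSymbol I S)
  out : X → List (WPSymbol I S)
  cnt : Fin D → List (WPSymbol I S)
  spare : Fin D → List (WPSymbol I S)

namespace WPMemory

variable {I S X : Type} {D : ℕ}

/-- The content of a stack. -/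
def get (m : WPMemory I S X D) : WPStack X D → List (WPSymbol I S)
  | .inp => m.inp
  | .work => m.work
  | .flag => m.flag
  | .clock => m.clock
  | .half => m.half
  | .out x => m.out x
  | .cnt j => m.cnt j
  | .spare j => m.spare j

theorem funext_get {σ : WPStack X D → List (WPSymbol I S)} {m : WPMemory I S X D}
    (h1 : σ .inp = m.inp) (h2 : σ .work = m.work) (h3 : σ .flag = m.flag)
    (h4 : σ .clock = m.clock) (h5 : σ .half = m.half) (h6 : ∀ x, σ (.out x) = m.out x)
    (h7 : ∀ j, σ (.cnt j) = m.cnt j) (h8 : ∀ j, σ (.spare j) = m.spare j) : σ = m.get := by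
  funext i
  cases i
  exacts [h1, h2, h3, h4, h5, h6 _, h7 _, h8 _]

end WPMemory

namespace StackMachine

variable {ι Γ : Type}

theorem RunsFrom.exit_of_eq {M : StackMachine ι Γ} {q : M.Q} {σ σ' : ι → List Γ}
    {ops : ι → StackOp Γ} (h : M.δ q (tops σ) = (none, ops)) (h' : applyOps ops σ = σ') :
    M.RunsFrom q σ 1 σ' := h' ▸ .exit h

theorem RunsFrom.step_of_eq {M : StackMachine ι Γ} {q q' : M.Q} {σ σ₁ σ' : ι → List Γ} {t : ℕ}
    {ops : ι → StackOp Γ} (h : M.δ q (tops σ) = (some q', ops)) (h' : applyOps ops σ = σ₁)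
    (hr : M.RunsFrom q' σ₁ t σ') : M.RunsFrom q σ (t + 1) σ' := by
  subst h'
  exact .step h hr

theorem RunsFrom.congr_right {M : StackMachine ι Γ} {q : M.Q} {σ σ' σ'' : ι → List Γ} {t : ℕ}
    (h : M.RunsFrom q σ t σ') (h' : σ' = σ'') : M.RunsFrom q σ t σ'' := h' ▸ h

theorem RunsFrom.congr_left {M : StackMachine ι Γ} {q : M.Q} {σ σ' σ'' : ι → List Γ} {t : ℕ}
    (h : M.RunsFrom q σ t σ') (h' : σ = σ'') : M.RunsFrom q σ'' t σ' := h' ▸ h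

theorem Runs.congr_right {M : StackMachine ι Γ} {σ σ' σ'' : ι → List Γ} {t : ℕ}
    (h : M.Runs σ t σ') (h' : σ' = σ'') : M.Runs σ t σ'' := h' ▸ h

/-! ### Basic programs -/

/-- A machine that performs one operation on each stack. -/
def once (ops : ι → StackOp Γ) : StackMachine ι Γ where
  Q := Unit
  start := ()
  δ _ _ := (none, ops)

theorem runs_once (ops : ι → StackOp Γ) (σ : ι → List Γ) :
    (once ops).Runs σ 1 (applyOps ops σ) := ⟨1, le_rfl, .exit rfl⟩

/-- Repeat a machine a fixed number of times. -/
def iter (M : StackMachine ι Γ) : ℕ → StackMachine ι Γ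
  | 0 => once fun _ => .keep
  | c + 1 => M.seq (iter M c)

open Classical in
/-- Move the stack `a` onto the stack `b`, reversing it. -/
noncomputable def pour (a b : ι) : StackMachine ι Γ where
  Q := Unit
  start := ()
  δ _ τ := match τ a with
    | none => (none, fun _ => .keep)
    | some c => (some (), fun i => if i = a then .pop else if i = b then .push c else .keep)

open Classical in
theorem runs_pour {a b : ι} (hab : a ≠ b) (σ : ι → List Γ) :
    (pour a b).Runs σ ((σ a).length + 1)
      (Function.update (Function.update σ a []) b ((σ a).reverse ++ σ b)) := by
  refine ⟨_, le_rfl, ?_⟩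
  change (pour a b).RunsFrom () _ _ _
  induction h : σ a generalizing σ with
  | nil =>
    refine .exit_of_eq (ops := fun _ => .keep) (by simp [pour, tops, h]) ?_
    rw [List.reverse_nil, List.nil_append, ← h, Function.update_eq_self, Function.update_eq_self]
    rfl
  | cons c l ih =>
    refine .step_of_eq (q' := ())
      (ops := fun i => if i = a then .pop else if i = b then .push c else .keep)
      (by simp [pour, tops, h]) rfl ?_
    have h1 := ih (applyOps (fun i => if i = a then .pop else if i = b then .push c else .keep) σ)
      (by simp [applyOps, StackOp.apply, h])
    refine h1.congr_right ?_
    funext i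
    by_cases hb : i = b
    · subst hb
      simp [applyOps, hab.symm, StackOp.apply]
    · by_cases ha : i = a
      · subst ha; simp [Function.update_of_ne hb]
      · simp [applyOps, ha, hb, StackOp.apply]

end StackMachine

/-! ### One pass -/

namespace InvAutomaton

open StackMachine

variable {I S X : Type} {D : ℕ} (A : InvAutomaton S X) (E : S → Prop)

/-- A word of states on a stack, with its first letter marked by `c`. -/
def markFirst (c : Bool) : List S → List (WPSymbol I S)
  | [] => []
  | s :: w => .letter s c :: w.map (.letter · false)

/-- A list of words of states on a stack. -/
def encodeWords (L : List (List S)) : List (WPSymbol I S) := L.flatMap (markFirst true)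

theorem length_markFirst (c : Bool) (w : List S) :
    (markFirst (I := I) c w).length = w.length := by
  cases w <;> simp [markFirst]

theorem markFirst_false (w : List S) : markFirst (I := I) false w = w.map (.letter · false) := by
  cases w <;> rfl

theorem markFirst_cons (c : Bool) (s : S) (w : List S) :
    markFirst (I := I) c (s :: w) = .letter s c :: markFirst false w := by
  rw [markFirst_false, markFirst]

theorem length_encodeWords (L : List (List S)) :
    (encodeWords (I := I) L).length = (L.map List.length).sum := by
  simp [encodeWords, List.length_flatMap, length_markFirst]

open Classical in
/-- The section of a word at a letter without its trivial letters. -/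
noncomputable def reducedStep (w : List S) (x : X) : List S :=
  (A.wstep w x).filter fun s => ¬ E s

theorem reducedStep_cons_pos {s : S} {x : X} (h : E (A.t s x)) (w : List S) :
    A.reducedStep E (s :: w) x = A.reducedStep E w (A.o s x) := by
  simp [reducedStep, wstep, h]

theorem reducedStep_cons_neg {s : S} {x : X} (h : ¬ E (A.t s x)) (w : List S) :
    A.reducedStep E (s :: w) x = A.t s x :: A.reducedStep E w (A.o s x) := by
  simp [reducedStep, wstep, h]

open Classical in
/-- Put a mark on the stack `l` unless `f` is the identity. -/
noncomputable def markUnlessId (f : X → X) (l : List (WPSymbol I S)) : List (WPSymbol I S) :=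
  if f = id then l else .mark :: l

/-- The marks left by the words in `L`, and by the word read before them, of image `f`. -/
noncomputable def marks : (X → X) → List (List S) → List (WPSymbol I S) → List (WPSymbol I S)
  | f, [], l => markUnlessId f l
  | f, w :: L, l => marks (A.wout w) L (markUnlessId f l)

theorem markUnlessId_eq_nil {f : X → X} {l : List (WPSymbol I S)} :
    markUnlessId f l = [] ↔ f = id ∧ l = [] := by
  unfold markUnlessId
  split_ifs with h <;> simp [h]

theorem marks_eq_nil {f : X → X} {L : List (List S)} {l : List (WPSymbol I S)} :
    A.marks f L l = [] ↔ (f = id ∧ l = []) ∧ ∀ w ∈ L, ∀ x, A.wout w x = x := by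
  induction L generalizing f l with
  | nil => simp [marks, markUnlessId_eq_nil]
  | cons w L ih =>
    simp only [marks, ih, markUnlessId_eq_nil, List.forall_mem_cons, funext_iff, id_eq]
    tauto

open Classical in
/-- The stack operations in reading the state `s`, where `f` and `b` are as in `readWords`. -/
noncomputable def readOps (s : S) (f : X → X) (b : X → Bool) (fl : Prop) :
    WPStack X D → StackOp (WPSymbol I S)
  | .work => .pop
  | .flag => if fl then .push .mark else .keep
  | .out x => if E (A.t s (f x)) then .keep else .push (.letter (A.t s (f x)) (b x))
  | _ => .keep

open Classical in
/-- Read the list of words on the stack `work`; write the reduced sections at the letter `x` onto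
`out x`, and put a mark on `flag` for each word that does not fix all letters. The state holds the
image of every letter under the part of the current word that has been read, and tells for which
letters `x` no letter of the section at `x` has been written. -/
noncomputable def readWords [Finite X] : StackMachine (WPStack X D) (WPSymbol I S) where
  Q := (X → X) × (X → Bool)
  start := (id, fun _ => true)
  δ q τ := match τ .work with
    | some (.letter s true) =>
      (some (A.o s, fun x => decide (E (A.t s x))),
        A.readOps E s id (fun _ => true) (q.1 ≠ id))
    | some (.letter s false) =>
      (some (fun x => A.o s (q.1 x), fun x => q.2 x && decide (E (A.t s (q.1 x)))),
        A.readOps E s q.1 q.2 False)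
    | _ => (none, fun i => match i with
        | .flag => if q.1 ≠ id then .push .mark else .keep
        | _ => .keep)

variable {A E}

theorem readWords_word [Finite X] {w : List S} {f : X → X} {b : X → Bool}
    {m : WPMemory I S X D} {l : List (WPSymbol I S)} {t : ℕ}
    {σ' : WPStack X D → List (WPSymbol I S)}
    (hm : m.work = w.map (.letter · false) ++ l)
    (h : ∀ b', (A.readWords E).RunsFrom (fun x => A.wout w (f x), b')
      { m with work := l, out := fun x =>
        (markFirst (b x) (A.reducedStep E w (f x))).reverse ++ m.out x }.get t σ') :
    (A.readWords E).RunsFrom (f, b) m.get (t + w.length) σ' := by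
  classical
  induction w generalizing f b m with
  | nil =>
    have := h b
    simp only [reducedStep, wstep, List.filter_nil, markFirst, List.reverse_nil,
      List.nil_append] at this
    have hm' : m.work = l := by simpa using hm
    subst hm'
    exact this
  | cons s w ih =>
    rw [List.length_cons, ← add_assoc]
    refine .step_of_eq (q' := (fun x => A.o s (f x), fun x => b x && decide (E (A.t s (f x)))))
      (σ₁ := { m with work := w.map (WPSymbol.letter · false) ++ l, out := fun x =>
        (if E (A.t s (f x)) then m.out x else .letter (A.t s (f x)) (b x) :: m.out x) }.get)
      (ops := A.readOps E s f b False)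
      (by simp [readWords, tops, WPMemory.get, hm]) ?_ (ih rfl fun b' => ?_)
    · refine WPMemory.funext_get rfl ?_ ?_ rfl rfl (fun x => ?_) (fun _ => rfl) (fun _ => rfl)
      · simp [applyOps, readOps, StackOp.apply, WPMemory.get, hm]
      · simp [applyOps, readOps, StackOp.apply, WPMemory.get]
      · simp only [applyOps, readOps, WPMemory.get]
        split_ifs <;> rfl
    · refine (h b').congr_left (congrArg WPMemory.get ?_)
      ext1 <;> try rfl
      funext x
      by_cases hE : E (A.t s (f x))
      · simp [hE, reducedStep_cons_pos]
      · simp [hE, reducedStep_cons_neg, markFirst_cons]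

/-- The end of a word is noticed only at the marked letter of the next word or at the bottom of the
stack, so `marks` begins with the image `f` of the word read before. -/
theorem readWords_words [Finite X] {L : List (List S)} (hL : ∀ w ∈ L, w ≠ []) {f : X → X}
    {b : X → Bool} {m : WPMemory I S X D} (hm : m.work = encodeWords L) :
    (A.readWords E).RunsFrom (f, b) m.get ((encodeWords (I := I) L).length + 1)
      { m with work := [], flag := A.marks f L m.flag, out := fun x =>
        (encodeWords (L.map (A.reducedStep E · x))).reverse ++ m.out x }.get := by
  classical
  induction L generalizing f b m with
  | nil =>
    have hm' : m.work = [] := hm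
    refine .exit_of_eq (ops := fun i => match i with
        | .flag => if f ≠ id then .push .mark else .keep
        | _ => .keep) (by simp [readWords, tops, WPMemory.get, hm']) ?_
    refine WPMemory.funext_get rfl hm' ?_ rfl rfl (fun x => ?_) (fun _ => rfl) (fun _ => rfl)
    · simp only [applyOps, WPMemory.get, marks, markUnlessId]
      by_cases h : f = id <;> simp [h, StackOp.apply]
    · rfl
  | cons w L ih =>
    obtain ⟨s, w, rfl⟩ := List.exists_cons_of_ne_nil (hL w (by simp))
    have hm' : m.work = .letter s true :: (w.map (.letter · false) ++ encodeWords L) := by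
      simp [hm, encodeWords, markFirst]
    have hlen : (encodeWords (I := I) ((s :: w) :: L)).length + 1 =
        (encodeWords (I := I) L).length + 1 + w.length + 1 := by
      simp [length_encodeWords]; omega
    rw [hlen]
    refine .step_of_eq (M := A.readWords E)
      (q' := ((A.o s, fun x => decide (E (A.t s x))) : (X → X) × (X → Bool)))
      (σ₁ := { m with work := w.map (WPSymbol.letter · false) ++ encodeWords L,
                      flag := markUnlessId f m.flag
                      out := fun x => (if E (A.t s x) then m.out x else
                        .letter (A.t s x) true :: m.out x) }.get)
      (ops := A.readOps E s id (fun _ => true) (f ≠ id))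
      (by simp [readWords, tops, WPMemory.get, hm']) ?_ (readWords_word rfl fun b' => ?_)
    · refine WPMemory.funext_get rfl ?_ ?_ rfl rfl (fun x => ?_) (fun _ => rfl) (fun _ => rfl)
      · simp [applyOps, readOps, StackOp.apply, WPMemory.get, hm']
      · simp only [applyOps, readOps, WPMemory.get, markUnlessId]
        by_cases h : f = id <;> simp [h, StackOp.apply]
      · simp only [applyOps, readOps, WPMemory.get, id]
        split_ifs <;> rfl
    · refine (ih (fun w hw => hL w (List.mem_cons_of_mem _ hw)) rfl).congr_right
        (congrArg WPMemory.get ?_)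
      ext1 <;> try rfl
      funext x
      by_cases hE : E (A.t s x)
      · simp [hE, reducedStep_cons_pos, encodeWords]
      · simp [hE, reducedStep_cons_neg, encodeWords, markFirst_cons]

/-- Move the stacks `out x` onto the stack `work`. -/
noncomputable def collect : List X → StackMachine (WPStack X D) (WPSymbol I S)
  | [] => once fun _ => .keep
  | x :: l => (pour (.out x) .work).seq (collect l)

-- The stacks `out x` hold their words backwards; pouring restores the reading order.
open Classical in
theorem runs_collect {xs : List X} (hxs : xs.Nodup) (m : WPMemory I S X D) :
    (collect xs).Runs m.get ((xs.map fun x => (m.out x).length + 1).sum + 1)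
      { m with work := xs.reverse.flatMap (fun x => (m.out x).reverse) ++ m.work
               out := fun x => if x ∈ xs then [] else m.out x }.get := by
  induction xs generalizing m with
  | nil =>
    refine (runs_once _ _).mono (by simp)
  | cons x l ih =>
    obtain ⟨hx, hl⟩ := List.nodup_cons.1 hxs
    have h1 := runs_pour (a := WPStack.out x) (b := .work) (by simp) m.get
    have h2 : Function.update (Function.update m.get (.out x) []) .work
        ((m.get (.out x)).reverse ++ m.get .work) =
        { m with work := (m.out x).reverse ++ m.work
                 out := fun y => if y = x then [] else m.out y }.get := by
      refine WPMemory.funext_get ?_ ?_ ?_ ?_ ?_ (fun y => ?_) (fun _ => ?_) (fun _ => ?_) <;>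
        simp [Function.update_apply, WPMemory.get]
    rw [h2] at h1
    have hy : ∀ y ∈ l, y ≠ x := fun y hy h => hx (h ▸ hy)
    have h3 : ∀ (l' : List X), (∀ y ∈ l', y ≠ x) →
        l'.flatMap (fun y => (if y = x then [] else m.out y).reverse) =
        l'.flatMap (fun y => (m.out y).reverse) := by
      intro l' hl'
      induction l' with
      | nil => rfl
      | cons z l' ih' =>
        simp only [List.flatMap_cons]
        rw [ih' fun y hy => hl' y (List.mem_cons_of_mem _ hy), if_neg (hl' z (by simp))]
    have h4 := h1.seq (ih hl { m with work := (m.out x).reverse ++ m.work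
                                      out := fun y => if y = x then [] else m.out y })
    have h5 : (l.map fun y => (if y = x then [] else m.out y).length + 1) =
        l.map fun y => (m.out y).length + 1 :=
      List.map_congr_left fun y hy' => by rw [if_neg (hy y hy')]
    simp only at h4
    rw [h3 l.reverse fun y hy' => hy y (List.mem_reverse.1 hy'), h5] at h4
    refine (h4.mono (by simp [WPMemory.get]; omega)).congr_right (congrArg WPMemory.get ?_)
    ext1 <;> try rfl
    · simp
    · funext y
      by_cases hyx : y = x <;> simp [hyx]

variable (A E) in
open Classical in
/-- The reduced sections of the words in `L` at all letters. -/
noncomputable def nextWords [Fintype X] (L : List (List S)) : List (List S) :=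
  Finset.univ.toList.flatMap fun x => (L.map (A.reducedStep E · x)).filter (· ≠ [])

/-- Empty words occupy no cell, so the machine drops them without any action. -/
theorem encodeWords_filter (L : List (List S)) [DecidablePred fun w : List S => w ≠ []] :
    encodeWords (I := I) (L.filter (· ≠ [])) = encodeWords L := by
  induction L with
  | nil => rfl
  | cons w L ih =>
    cases w with
    | nil => simpa [encodeWords, markFirst] using ih
    | cons s w => simpa [encodeWords, markFirst] using ih

theorem encodeWords_nextWords [Fintype X] (L : List (List S)) :
    encodeWords (I := I) (A.nextWords E L) =
      (Finset.univ : Finset X).toList.flatMap fun x => encodeWords (L.map (A.reducedStep E · x)) := by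
  classical
  simp only [nextWords]
  generalize (Finset.univ : Finset X).toList = l
  induction l with
  | nil => rfl
  | cons x l ih =>
    simp only [List.flatMap_cons, ← ih]
    rw [← encodeWords_filter (L.map _)]
    simp [encodeWords]

theorem ne_nil_of_mem_nextWords [Fintype X] {L : List (List S)} {w : List S}
    (hw : w ∈ A.nextWords E L) : w ≠ [] := by
  simp only [nextWords, List.mem_flatMap, List.mem_filter] at hw
  obtain ⟨x, -, -, h⟩ := hw
  simpa using h

variable (A E) in
/-- Replace the list of words on the stack `work` by the list of reduced sections at all letters,
and mark the words that do not fix all letters. -/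
noncomputable def passMachine [Fintype X] : StackMachine (WPStack X D) (WPSymbol I S) :=
  (A.readWords E).seq (collect Finset.univ.toList.reverse)

theorem runs_passMachine [Fintype X] {L : List (List S)} (hL : ∀ w ∈ L, w ≠ [])
    {m : WPMemory I S X D} (hm : m.work = encodeWords L) (hout : m.out = fun _ => []) :
    (A.passMachine E).Runs m.get
      ((L.map List.length).sum + ((A.nextWords E L).map List.length).sum + Fintype.card X + 2)
      { m with work := encodeWords (A.nextWords E L), flag := A.marks id L m.flag }.get := by
  classical
  have h1 : (A.readWords E).Runs m.get _ _ :=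
    ⟨_, le_rfl, readWords_words (A := A) (E := E) hL (f := id) (b := fun _ => true) hm⟩
  -- The stack poured last ends on top, hence the reversed list of letters.
  have h2 := h1.seq (runs_collect (xs := Finset.univ.toList.reverse)
    (by simpa using Finset.nodup_toList _) _)
  have h3 : (Finset.univ.toList.reverse.map fun x : X =>
      ((encodeWords (I := I) (L.map (A.reducedStep E · x))).reverse ++ m.out x).length + 1).sum =
      ((A.nextWords E L).map List.length).sum + Fintype.card X := by
    rw [← length_encodeWords (I := I), encodeWords_nextWords, List.length_flatMap, hout]
    simp only [List.append_nil, List.length_reverse, List.map_reverse, List.sum_reverse]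
    rw [List.sum_map_add]
    simp
  simp only at h2
  rw [h3, length_encodeWords] at h2
  refine (h2.mono (by omega)).congr_right (congrArg WPMemory.get ?_)
  ext1 <;> try rfl
  · simp [encodeWords_nextWords, hout]
  · funext x
    simp [hout]

end InvAutomaton

theorem Nat.size_eq_size_half_add_one {n : ℕ} (hn : n ≠ 0) : n.size = (n / 2).size + 1 := by
  refine eq_of_forall_ge_iff fun m => ?_
  cases m with
  | zero => simp [Nat.size_eq_zero, hn]
  | succ m => rw [Nat.add_le_add_iff_right, Nat.size_le, Nat.size_le, pow_succ]; omega

namespace StackMachine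

variable {ι Γ : Type}

theorem runs_iter {M : StackMachine ι Γ} {K B : ℕ} {σ : ℕ → ι → List Γ}
    (hM : ∀ i < K, M.Runs (σ i) B (σ (i + 1))) (c i : ℕ) (hc : i + c ≤ K) :
    (M.iter c).Runs (σ i) (c * B + 1) (σ (i + c)) := by
  induction c generalizing i with
  | zero => exact (runs_once _ _).mono (by omega)
  | succ c ih =>
    have h := (hM i (by omega)).seq (ih (i + 1) (by omega))
    rw [show i + 1 + c = i + (c + 1) by omega] at h
    exact h.mono (by rw [Nat.succ_mul]; omega)

/-! ### Nested loops -/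

section Nest

variable {I S X : Type} {D : ℕ}

open Classical in
/-- Run the machine once for each symbol on the stack `cnt j`, which is restored. -/
noncomputable def forLoop (j : Fin D) (M : StackMachine (WPStack X D) (WPSymbol I S)) :
    StackMachine (WPStack X D) (WPSymbol I S) :=
  (loop (.cnt j) ((once fun i =>
    if i = .cnt j then .pop else if i = .spare j then .push .mark else .keep).seq M)).seq
    (pour (.spare j) (.cnt j))

/-- Loops nested in each other over the stacks `cnt j` for all `j` in the list. -/
noncomputable def nest (M : StackMachine (WPStack X D) (WPSymbol I S)) :
    List (Fin D) → StackMachine (WPStack X D) (WPSymbol I S)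
  | [] => M
  | j :: l => forLoop j (nest M l)

variable {m : ℕ → WPMemory I S X D} {K r B : ℕ}

/-- The family `m` lists successive memories, and each run of the body advances by `r`. Meanwhile
the marks travel from `cnt j` to `spare j`, so `hM` admits any contents of these two; the final pour
makes the counter available again to outer loops. -/
theorem runs_forLoop {M : StackMachine (WPStack X D) (WPSymbol I S)} {j : Fin D}
    {c s : Fin D → List (WPSymbol I S)} {l : ℕ}
    (hM : ∀ i a b, i + r ≤ K →
      M.Runs { m i with cnt := Function.update c j a, spare := Function.update s j b }.get B
        { m (i + r) with cnt := Function.update c j a, spare := Function.update s j b }.get)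
    (hc : c j = List.replicate l .mark) (hs : s j = []) (i : ℕ) (hi : i + r * l ≤ K) :
    (forLoop j M).Runs { m i with cnt := c, spare := s }.get (l * (B + 3) + 2)
      { m (i + r * l) with cnt := c, spare := s }.get := by
  classical
  have key : ∀ a b i, i + r * a ≤ K →
      (loop (.cnt j) ((once fun i =>
        if i = .cnt j then .pop else if i = .spare j then .push .mark else .keep).seq M)).Runs
        { m i with cnt := Function.update c j (List.replicate a .mark)
                   spare := Function.update s j (List.replicate b .mark) }.get (a * (B + 2) + 1)
        { m (i + r * a) with cnt := Function.update c j []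
                             spare := Function.update s j (List.replicate (a + b) .mark) }.get := by
    intro a
    induction a with
    | zero =>
      intro b i _
      rw [Nat.mul_zero, Nat.add_zero, Nat.zero_mul, Nat.zero_add, Nat.zero_add]
      exact runs_loop_nil _ (by simp [WPMemory.get])
    | succ a ih =>
      intro b i hi
      rw [Nat.mul_succ] at hi
      have h1 : (once (fun i : WPStack X D => if i = .cnt j then StackOp.pop else
          if i = .spare j then .push (WPSymbol.mark : WPSymbol I S) else .keep)).Runs
          { m i with cnt := Function.update c j (List.replicate (a + 1) .mark)
                     spare := Function.update s j (List.replicate b .mark) }.get 1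
          { m i with cnt := Function.update c j (List.replicate a .mark)
                     spare := Function.update s j (List.replicate (b + 1) .mark) }.get := by
        refine (runs_once _ _).congr_right ?_
        refine WPMemory.funext_get ?_ ?_ ?_ ?_ ?_ (fun _ => ?_) (fun k => ?_) (fun k => ?_)
        iterate 6 simp [applyOps, WPMemory.get, StackOp.apply]
        · by_cases hk : k = j
          · subst hk; simp [applyOps, WPMemory.get, StackOp.apply]
          · simp [applyOps, WPMemory.get, StackOp.apply, hk]
        · by_cases hk : k = j
          · subst hk; simp [applyOps, WPMemory.get, StackOp.apply, List.replicate_succ]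
          · simp [applyOps, WPMemory.get, StackOp.apply, hk]
      have h2 := runs_loop_cons (i := .cnt j) (by simp [WPMemory.get, List.replicate_succ])
        (h1.seq (hM i _ _ (by omega))) (ih (b + 1) (i + r) (by omega))
      rw [show i + r + r * a = i + r * (a + 1) by ring,
        show a + (b + 1) = a + 1 + b by omega] at h2
      exact h2.mono (by rw [Nat.succ_mul]; omega)
  have h1 := key l 0 i hi
  have hc' : Function.update c j (List.replicate l .mark) = c := by rw [← hc]; simp
  have hs' : Function.update s j (List.replicate 0 .mark) = s := by
    rw [List.replicate_zero, ← hs]; simp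
  rw [hc', hs', Nat.add_zero] at h1
  have h2 := h1.seq (runs_pour (a := WPStack.spare j) (b := .cnt j) (by simp) _)
  refine (h2.mono ?_).congr_right ?_
  · simp only [WPMemory.get, Function.update_self, List.length_replicate]
    nlinarith
  · refine WPMemory.funext_get ?_ ?_ ?_ ?_ ?_ (fun _ => ?_) (fun k => ?_) (fun k => ?_)
    iterate 6 simp [WPMemory.get]
    · by_cases hk : k = j <;> simp [WPMemory.get, hk, hc]
    · by_cases hk : k = j <;> simp [WPMemory.get, hk, hs]

theorem runs_nest {M : StackMachine (WPStack X D) (WPSymbol I S)}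
    (hM : ∀ i c s, i + r ≤ K → M.Runs { m i with cnt := c, spare := s }.get B
      { m (i + r) with cnt := c, spare := s }.get) {n : ℕ} {l : List (Fin D)} (hl : l.Nodup)
    {c s : Fin D → List (WPSymbol I S)}
    (hc : ∀ j ∈ l, c j = List.replicate n .mark) (hs : ∀ j ∈ l, s j = []) (i : ℕ)
    (hi : i + r * n ^ l.length ≤ K) :
    (nest M l).Runs { m i with cnt := c, spare := s }.get ((n + 2) ^ l.length * (B + 6))
      { m (i + r * n ^ l.length) with cnt := c, spare := s }.get := by
  classical
  -- A loop changes the cost from `B` to `n * (B + 3) + 2`. After adding `6` this is at most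
  -- multiplication by `n + 2`, which iterates well.
  suffices h : ∃ B', B' + 6 ≤ (n + 2) ^ l.length * (B + 6) ∧ ∀ i, i + r * n ^ l.length ≤ K →
      ∀ c s : Fin D → List (WPSymbol I S), (∀ j ∈ l, c j = List.replicate n .mark) →
      (∀ j ∈ l, s j = []) → (nest M l).Runs { m i with cnt := c, spare := s }.get B'
        { m (i + r * n ^ l.length) with cnt := c, spare := s }.get by
    obtain ⟨B', hB', h⟩ := h
    exact (h i hi c s hc hs).mono (by omega)
  clear hc hs hi
  induction l with
  | nil => exact ⟨B, by simp, fun i hi c s _ _ => by simpa [nest] using hM i c s (by simpa using hi)⟩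
  | cons j l ih =>
    obtain ⟨hj, hl⟩ := List.nodup_cons.1 hl
    obtain ⟨B', hB', h⟩ := ih hl
    refine ⟨n * (B' + 3) + 2, ?_, fun i hi c s hc hs => ?_⟩
    · rw [List.length_cons, pow_succ]
      calc n * (B' + 3) + 2 + 6 ≤ (n + 2) * (B' + 6) := by nlinarith
        _ ≤ (n + 2) * ((n + 2) ^ l.length * (B + 6)) := Nat.mul_le_mul_left _ hB'
        _ = _ := by ring
    · have h1 := runs_forLoop (m := m) (K := K) (r := r * n ^ l.length) (M := nest M l) (j := j)
        (c := c) (s := s) (l := n) (B := B') (fun i a b hi => h i hi _ _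
          (fun k hk => by
            rw [Function.update_of_ne (show k ≠ j from fun h => hj (h ▸ hk))]
            exact hc k (List.mem_cons_of_mem _ hk))
          (fun k hk => by
            rw [Function.update_of_ne (show k ≠ j from fun h => hj (h ▸ hk))]
            exact hs k (List.mem_cons_of_mem _ hk)))
        (hc j (by simp)) (hs j (by simp)) i
        (by rw [List.length_cons, pow_succ, ← mul_assoc] at hi; exact hi)
      rw [List.length_cons, pow_succ, ← mul_assoc]
      exact h1

end Nest

/-! ### Input and clock -/

section Setup

variable {I S X : Type} {D : ℕ}

/-- Replace the input letters by words of states, with a tally mark on `clock` for each of them,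
and put the state `e` on top. -/
def expand [Finite S] (rep : I → List S) (r : ℕ) (hr : ∀ a, (rep a).length ≤ r) (e : S) :
    StackMachine (WPStack X D) (WPSymbol I S) :=
  have : Finite {l : List S // l.length ≤ r} := (List.finite_length_le S r).to_subtype
  { Q := Option {l : List S // l.length ≤ r}
    start := none
    δ := fun q τ => match q with
      | none => match τ .inp with
        | some (.inp a) => (some (some ⟨(rep a).reverse, by simpa using hr a⟩), fun i => match i with
          | .inp => .pop
          | .clock => .push .mark
          | _ => .keep)
        | _ => (none, fun i => match i with
          | .work => .push (.letter e true)
          | _ => .keep)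
      | some ⟨[], _⟩ => (some none, fun _ => .keep)
      | some ⟨s :: l, h⟩ => (some (some ⟨l, (Nat.le_succ _).trans h⟩), fun i => match i with
          | .work => .push (.letter s false)
          | _ => .keep) }

theorem expand_push [Finite S] {rep : I → List S} {r : ℕ} {hr : ∀ a, (rep a).length ≤ r} {e : S}
    {l : List S} (hl : l.length ≤ r) {m : WPMemory I S X D} {t : ℕ}
    {σ' : WPStack X D → List (WPSymbol I S)}
    (h : (expand rep r hr e).RunsFrom (none : Option {l : List S // l.length ≤ r})
      { m with work := l.reverse.map (WPSymbol.letter · false) ++ m.work }.get t σ') :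
    (expand rep r hr e).RunsFrom (some ⟨l, hl⟩ : Option {l : List S // l.length ≤ r})
      m.get (t + 1 + l.length) σ' := by
  induction l generalizing m with
  | nil => exact .step_of_eq (ops := fun _ => .keep) rfl rfl h
  | cons s l ih =>
    refine .step_of_eq (M := expand rep r hr e)
      (q' := (some ⟨l, (Nat.le_succ _).trans hl⟩ : Option {l : List S // l.length ≤ r})) rfl ?_
      (ih (m := { m with work := .letter s false :: m.work }) _ (by simpa using h))
    exact WPMemory.funext_get rfl rfl rfl rfl rfl (fun _ => rfl) (fun _ => rfl) (fun _ => rfl)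

/-- The input letter read last ends on top, so the input is reversed; this fits, as words of states
act from left to right and products of permutations from right to left. The marked `e` on top
supplies the first-letter mark and makes the word nonempty. -/
theorem runs_expand [Finite S] {rep : I → List S} {r : ℕ} {hr : ∀ a, (rep a).length ≤ r} {e : S}
    {w : List I} {m : WPMemory I S X D} (hm : m.inp = w.map .inp) :
    (expand rep r hr e).Runs m.get (w.length * (r + 2) + 1)
      { m with inp := []
               work := .letter e true ::
                ((w.reverse.flatMap rep).map (WPSymbol.letter · false) ++ m.work)
               clock := List.replicate w.length WPSymbol.mark ++ m.clock }.get := by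
  change ∃ t ≤ _, (expand rep r hr e).RunsFrom (none : Option {l : List S // l.length ≤ r}) _ _ _
  induction w generalizing m with
  | nil =>
    refine ⟨1, by omega, .exit_of_eq (ops := fun i => match i with
          | .work => .push (.letter e true)
          | _ => .keep) ?_ ?_⟩
    · have h : tops m.get .inp = none := by simp [tops, WPMemory.get, hm]
      simp only [expand, h]
    · exact WPMemory.funext_get hm rfl rfl rfl rfl (fun _ => rfl) (fun _ => rfl) (fun _ => rfl)
  | cons a w ih =>
    obtain ⟨t, ht, h⟩ := ih (m := { m with
      inp := w.map .inp
      work := (rep a).map (WPSymbol.letter · false) ++ m.work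
      clock := .mark :: m.clock }) rfl
    refine ⟨t + 1 + (rep a).reverse.length + 1, ?_, ?_⟩
    · have := hr a
      rw [List.length_reverse, List.length_cons, Nat.succ_mul]
      omega
    · refine .step_of_eq (M := expand rep r hr e)
        (q' := (some ⟨(rep a).reverse, by simpa using hr a⟩ : Option {l : List S // l.length ≤ r}))
        (σ₁ := { m with inp := w.map .inp, clock := .mark :: m.clock }.get)
        (ops := fun i => match i with
          | .inp => .pop
          | .clock => .push .mark
          | _ => .keep) ?_ ?_ (expand_push _ ?_)
      · have h : tops m.get .inp = some (.inp a) := by simp [tops, WPMemory.get, hm]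
        simp only [expand, h]
      · exact WPMemory.funext_get (by simp [applyOps, WPMemory.get, hm, StackOp.apply])
          rfl rfl rfl rfl (fun _ => rfl) (fun _ => rfl) (fun _ => rfl)
      · have h' := h.congr_right (σ'' := { m with
            inp := []
            work := .letter e true ::
              (((a :: w).reverse.flatMap rep).map (WPSymbol.letter · false) ++ m.work)
            clock := List.replicate (a :: w).length WPSymbol.mark ++ m.clock }.get)
          (congrArg WPMemory.get (by
            ext1 <;> try rfl
            · simp
            · simp [List.replicate_succ', List.append_assoc]))
        simpa using h'

/-- Halve the number of symbols while moving them from `clock` to `half`. -/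
def halve : StackMachine (WPStack X D) (WPSymbol I S) where
  Q := Bool
  start := false
  δ b τ := match τ .clock with
    | some _ => (some !b, fun i => match i with
      | .clock => .pop
      | .half => if b then .push .mark else .keep
      | _ => .keep)
    | none => (none, fun _ => .keep)

theorem runsFrom_halve {n : ℕ} {b : Bool} {m : WPMemory I S X D}
    (hm : m.clock = List.replicate n .mark) :
    halve.RunsFrom b m.get (n + 1)
      { m with clock := []
               half := List.replicate ((n + b.toNat) / 2) WPSymbol.mark ++ m.half }.get := by
  induction n generalizing b m with
  | zero =>
    refine .exit_of_eq (ops := fun _ => .keep) ?_ ?_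
    · have h : tops m.get .clock = none := by simp [tops, WPMemory.get, hm]
      simp only [halve, h]
    · refine WPMemory.funext_get rfl rfl rfl hm ?_ (fun _ => rfl) (fun _ => rfl) (fun _ => rfl)
      cases b <;> rfl
  | succ n ih =>
    refine .step_of_eq (M := halve) (q' := (!b : Bool))
      (σ₁ := { m with clock := List.replicate n .mark
                      half := if b then .mark :: m.half else m.half }.get)
      (ops := fun i => match i with
        | .clock => .pop
        | .half => if b then .push .mark else .keep
        | _ => .keep) ?_ ?_ ((ih rfl).congr_right (congrArg WPMemory.get ?_))
    · have h : tops m.get .clock = some .mark := by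
        simp [tops, WPMemory.get, hm, List.replicate_succ]
      simp only [halve, h]
    · refine WPMemory.funext_get rfl rfl rfl ?_ ?_ (fun _ => rfl) (fun _ => rfl) (fun _ => rfl)
      · simp [applyOps, WPMemory.get, StackOp.apply, hm, List.replicate_succ]
      · cases b <;> rfl
    · ext1 <;> try rfl
      cases b
      · simp
      · simp only [if_true, Bool.not_true, Bool.toNat_false, Bool.toNat_true]
        rw [show (n + 1 + 1) / 2 = (n + 0) / 2 + 1 by omega, List.replicate_succ']
        simp

/-- Put a tally mark on all stacks `cnt j`. -/
def tick : StackMachine (WPStack X D) (WPSymbol I S) :=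
  once fun i => match i with
    | .cnt _ => .push .mark
    | _ => .keep

/-- Put as many marks on the stacks `cnt j` as the number of marks on `clock` has binary digits. -/
noncomputable def setClock : StackMachine (WPStack X D) (WPSymbol I S) :=
  loop .clock (halve.seq ((pour .half .clock).seq tick))

/-- Each halving removes one binary digit of the tally and adds one mark to all counters. The bound
of order `n * n.size` is crude but suffices, because the final bound has at least one logarithmic
factor. -/
theorem runs_setClock {n c : ℕ} {m : WPMemory I S X D}
    (hm : m.clock = List.replicate n .mark) (hh : m.half = [])
    (hc : m.cnt = fun _ => List.replicate c .mark) :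
    setClock.Runs m.get (n.size * (2 * n + 4) + 1)
      { m with clock := [], cnt := fun _ => List.replicate (c + n.size) .mark }.get := by
  classical
  induction n using Nat.strong_induction_on generalizing c m with
  | _ n ih =>
    rcases eq_or_ne n 0 with rfl | hn
    · have hm' : m.get .clock = [] := hm
      refine ((runs_loop_nil _ hm').mono (Nat.le_add_left _ _)).congr_right
        (congrArg WPMemory.get ?_)
      ext1 <;> try rfl
      · exact hm'
      · exact hc
    · have h1 : halve.Runs m.get (n + 1) _ := ⟨_, le_rfl, runsFrom_halve (b := false) hm⟩
      have h2 := h1.seq ((runs_pour (a := WPStack.half) (b := .clock) (by simp) _).seq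
        (runs_once (fun i : WPStack X D => match i with
          | .cnt _ => .push (WPSymbol.mark : WPSymbol I S)
          | _ => .keep) _))
      have h3 := h2.congr_right (σ'' := { m with
          clock := List.replicate (n / 2) .mark
          cnt := fun _ => List.replicate (c + 1) .mark }.get) (by
        refine WPMemory.funext_get ?_ ?_ ?_ ?_ ?_ (fun _ => ?_) (fun _ => ?_) (fun _ => ?_) <;>
          simp [applyOps, StackOp.apply, WPMemory.get, hh, hc, List.replicate_succ])
      have h4 := runs_loop_cons (i := .clock) (by simp [WPMemory.get, hm, hn]) h3
        (ih (n / 2) (by omega) (c := c + 1) rfl hh rfl)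
      rw [Nat.size_eq_size_half_add_one hn]
      refine (h4.mono ?_).congr_right (congrArg WPMemory.get ?_)
      · simp only [WPMemory.get, hh, Bool.toNat_false, Nat.add_zero, List.append_nil,
          List.length_replicate]
        have : (n / 2).size * (2 * (n / 2) + 4) ≤ (n / 2).size * (2 * n + 4) :=
          Nat.mul_le_mul_left _ (by omega)
        rw [show ((n / 2).size + 1) * (2 * n + 4) = (n / 2).size * (2 * n + 4) + (2 * n + 4) by ring]
        omega
      · ext1 <;> try rfl
        funext
        simp only
        congr 1
        omega

end Setup

end StackMachine

namespace InvAutomaton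

open StackMachine

section Words

variable {I S X : Type} {D : ℕ} {A : InvAutomaton S X} {E : S → Prop}

open Classical in
theorem wout_filter (hEo : ∀ s, E s → A.o s = 1) (w : List S) (x : X) :
    A.wout (w.filter fun s => ¬ E s) x = A.wout w x := by
  induction w generalizing x with
  | nil => rfl
  | cons s w ih =>
    by_cases h : E s
    · simpa [h, wout, hEo s h] using ih x
    · simpa [h, wout] using ih _

open Classical in
-- States in `E` move no letter and stay in `E`, so deleting them early changes nothing.
theorem filter_wstep_filter (hE : ∀ s x, E s → A.t s x = s) (hEo : ∀ s, E s → A.o s = 1)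
    (w : List S) (x : X) :
    (A.wstep (w.filter fun s => ¬ E s) x).filter (fun s => ¬ E s) =
      (A.wstep w x).filter fun s => ¬ E s := by
  induction w generalizing x with
  | nil => rfl
  | cons s w ih =>
    by_cases h : E s
    · simpa [h, wstep, hE s x h, hEo s h] using ih x
    · have := ih (A.o s x)
      by_cases h' : E (A.t s x)
      · simpa [h, h', wstep] using this
      · simpa [h, h', wstep] using this

open Classical in
theorem triv_filter (hE : ∀ s x, E s → A.t s x = s) (hEo : ∀ s, E s → A.o s = 1) (k : ℕ)
    (w : List S) : A.triv k (w.filter fun s => ¬ E s) ↔ A.triv k w := by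
  induction k generalizing w with
  | zero => exact Iff.rfl
  | succ k ih =>
    refine and_congr (forall_congr' fun x => by rw [wout_filter hEo]) (forall_congr' fun x => ?_)
    rw [← ih, filter_wstep_filter hE hEo, ih]

theorem triv_nil (k : ℕ) : A.triv k [] := by
  induction k with
  | zero => trivial
  | succ k ih => exact ⟨fun _ => rfl, fun _ => ih⟩

theorem forall_nextWords_triv [Fintype X] (hE : ∀ s x, E s → A.t s x = s)
    (hEo : ∀ s, E s → A.o s = 1) (k : ℕ) (L : List (List S)) :
    (∀ w ∈ A.nextWords E L, A.triv k w) ↔ ∀ w ∈ L, ∀ x, A.triv k (A.wstep w x) := by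
  simp only [nextWords, List.mem_flatMap, List.mem_filter, List.mem_map, Finset.mem_toList]
  constructor
  · intro h w hw x
    rw [← triv_filter hE hEo]
    by_cases h0 : A.reducedStep E w x = []
    · change A.triv k (A.reducedStep E w x)
      rw [h0]
      exact triv_nil k
    · exact h _ ⟨x, Finset.mem_univ x, ⟨w, hw, rfl⟩, decide_eq_true h0⟩
  · rintro h _ ⟨x, -, ⟨w, hw, rfl⟩, -⟩
    exact (triv_filter hE hEo k _).2 (h w hw x)

theorem forall_triv_iff [Fintype X] (hE : ∀ s x, E s → A.t s x = s)
    (hEo : ∀ s, E s → A.o s = 1) (k : ℕ) (L : List (List S)) :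
    (∀ w ∈ L, A.triv k w) ↔ ∀ i < k, ∀ w ∈ (A.nextWords E)^[i] L, ∀ x, A.wout w x = x := by
  induction k generalizing L with
  | zero => simp [triv]
  | succ k ih =>
    have h1 : (∀ w ∈ L, A.triv (k + 1) w) ↔
        (∀ w ∈ L, ∀ x, A.wout w x = x) ∧ ∀ w ∈ A.nextWords E L, A.triv k w := by
      rw [forall_nextWords_triv hE hEo]
      exact ⟨fun h => ⟨fun w hw => (h w hw).1, fun w hw => (h w hw).2⟩,
        fun h w hw => ⟨h.1 w hw, h.2 w hw⟩⟩
    rw [h1, ih]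
    constructor
    · rintro ⟨h2, h3⟩ i hi
      cases i with
      | zero => exact h2
      | succ i => exact h3 i (by omega)
    · exact fun h => ⟨h 0 (by omega), fun i hi => h (i + 1) (by omega)⟩

/-! ### The size of the lists of words -/

variable (A E) in
/-- The number of nontrivial sections of the letters of a word on level `k`. -/
noncomputable def wordActivity [Fintype X] (k : ℕ) (w : List S) : ℕ :=
  (w.map (A.activity E k)).sum

/-- As `x` runs over the alphabet, each state of the word receives every letter exactly once,
because the states before it permute the letters. -/
theorem sum_wordActivity_wstep [Fintype X] (k : ℕ) (w : List S) :
    ∑ x, A.wordActivity E k (A.wstep w x) = A.wordActivity E (k + 1) w := by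
  induction w with
  | nil => simp [wordActivity, wstep]
  | cons s w ih =>
    simp only [wordActivity, wstep, List.map_cons, List.sum_cons] at ih ⊢
    rw [Finset.sum_add_distrib, ← ih,
      Equiv.sum_comp (A.o s) fun x => ((A.wstep w x).map (A.activity E k)).sum]
    rfl

theorem wordActivity_reducedStep_le [Fintype X] (k : ℕ) (w : List S) (x : X) :
    A.wordActivity E k (A.reducedStep E w x) ≤ A.wordActivity E k (A.wstep w x) :=
  (List.Sublist.map _ List.filter_sublist).sum_le_sum fun _ _ => Nat.zero_le _

theorem sum_wordActivity_nextWords_le [Fintype X] (k : ℕ) (L : List (List S)) :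
    ((A.nextWords E L).map (A.wordActivity E k)).sum ≤
      (L.map (A.wordActivity E (k + 1))).sum := by
  classical
  have h1 : ((A.nextWords E L).map (A.wordActivity E k)).sum ≤
      ∑ x, (L.map fun w => A.wordActivity E k (A.wstep w x)).sum := by
    rw [← Finset.sum_map_toList, nextWords]
    generalize (Finset.univ : Finset X).toList = l
    induction l with
    | nil => simp
    | cons x l ih =>
      rw [List.flatMap_cons, List.map_append, List.sum_append, List.map_cons, List.sum_cons]
      refine Nat.add_le_add ?_ ih
      refine ((List.Sublist.map _ List.filter_sublist).sum_le_sum fun _ _ => Nat.zero_le _).trans ?_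
      rw [List.map_map]
      exact List.sum_le_sum fun w _ => wordActivity_reducedStep_le k w x
  refine h1.trans (le_of_eq ?_)
  clear h1
  induction L with
  | nil => simp
  | cons w L ih =>
    simp only [List.map_cons, List.sum_cons]
    rw [Finset.sum_add_distrib, sum_wordActivity_wstep, ih]

theorem sum_wordActivity_iterate_le [Fintype X] (i k : ℕ) (L : List (List S)) :
    (((A.nextWords E)^[i] L).map (A.wordActivity E k)).sum ≤
      (L.map (A.wordActivity E (i + k))).sum := by
  induction i generalizing k with
  | zero => simp
  | succ i ih =>
    rw [Function.iterate_succ_apply']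
    refine (sum_wordActivity_nextWords_le k _).trans ((ih (k + 1)).trans (le_of_eq ?_))
    rw [show i + (k + 1) = i + 1 + k by omega]

theorem length_eq_wordActivity [Fintype X] {w : List S} (hw : ∀ s ∈ w, ¬ E s) :
    w.length = A.wordActivity E 0 w := by
  induction w with
  | nil => rfl
  | cons s w ih =>
    have h1 : A.activity E 0 s = 1 := by simp [activity, hw s (by simp)]
    have h2 := ih fun a ha => hw a (List.mem_cons_of_mem _ ha)
    simp only [wordActivity, List.map_cons, List.sum_cons] at h2 ⊢
    rw [h1, List.length_cons, h2, Nat.add_comm]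

theorem not_mem_of_mem_nextWords [Fintype X] {L : List (List S)} {w : List S}
    (hw : w ∈ A.nextWords E L) {s : S} (hs : s ∈ w) : ¬ E s := by
  simp only [nextWords, List.mem_flatMap, List.mem_filter, List.mem_map] at hw
  obtain ⟨x, -, ⟨u, -, rfl⟩, -⟩ := hw
  simpa using (List.mem_filter.1 hs).2

/-- The total length of the words after `i` passes. -/
theorem sum_length_iterate_le [Fintype X] {C d : ℕ}
    (hact : ∀ s n, A.activity E n s ≤ C * (n + 1) ^ d) (i : ℕ) (w : List S) :
    (((A.nextWords E)^[i] [w]).map List.length).sum ≤ w.length * ((C + 1) * (i + 1) ^ d) := by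
  -- Only after a first pass are the words free of states in `E`; the initial word is treated apart,
  -- and `C + 1` instead of `C` covers it.
  cases i with
  | zero =>
    simp only [Function.iterate_zero, id, List.map_cons, List.map_nil, List.sum_cons, List.sum_nil]
    exact Nat.le_mul_of_pos_right _ (by positivity)
  | succ i =>
    have h1 : (((A.nextWords E)^[i + 1] [w]).map List.length).sum =
        (((A.nextWords E)^[i + 1] [w]).map (A.wordActivity E 0)).sum := by
      congr 1
      refine List.map_congr_left fun u hu => length_eq_wordActivity fun s hs => ?_
      rw [Function.iterate_succ_apply'] at hu
      exact not_mem_of_mem_nextWords hu hs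
    rw [h1]
    refine (sum_wordActivity_iterate_le (i + 1) 0 [w]).trans ?_
    simp only [List.map_cons, List.map_nil, List.sum_cons, List.sum_nil, Nat.add_zero]
    refine (List.sum_le_card_nsmul _ ((C + 1) * (i + 1 + 1) ^ d) fun a ha => ?_).trans (by simp)
    obtain ⟨s, -, rfl⟩ := List.mem_map.1 ha
    exact (hact s _).trans (Nat.mul_le_mul_right _ (Nat.le_succ C))

/-! ### The machine for the word problem -/

variable (A E) in
/-- The words and the marks after `i` passes that start with the word `w`. -/
noncomputable def passMarks [Fintype X] (w : List S) : ℕ → List (WPSymbol I S)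
  | 0 => []
  | i + 1 => A.marks id ((A.nextWords E)^[i] [w]) (passMarks w i)

theorem passMarks_eq_nil [Fintype X] (w : List S) (k : ℕ) :
    A.passMarks E (I := I) w k = [] ↔
      ∀ i < k, ∀ u ∈ (A.nextWords E)^[i] [w], ∀ x, A.wout u x = x := by
  induction k with
  | zero => simp [passMarks]
  | succ k ih =>
    simp only [passMarks, marks_eq_nil, ih, true_and]
    constructor
    · rintro ⟨h1, h2⟩ i hi
      rcases Nat.lt_succ_iff_lt_or_eq.1 hi with hi | rfl
      exacts [h1 i hi, h2]
    · exact fun h => ⟨fun i hi => h i (hi.trans k.lt_succ_self), h k k.lt_succ_self⟩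

variable (A E) in
/-- The memory after `i` passes. -/
noncomputable def passMemory [Fintype X] (w : List S) (c s : Fin D → List (WPSymbol I S)) (i : ℕ) :
    WPMemory I S X D where
  inp := []
  work := encodeWords ((A.nextWords E)^[i] [w])
  flag := A.passMarks E w i
  clock := []
  half := []
  out _ := []
  cnt := c
  spare := s

theorem runs_passMachine_passMemory [Fintype X] {C d : ℕ}
    (hact : ∀ s n, A.activity E n s ≤ C * (n + 1) ^ d) {w : List S} (hw : w ≠ [])
    (c s : Fin D → List (WPSymbol I S)) {i K : ℕ} (hi : i < K) :
    (A.passMachine E).Runs (A.passMemory E w c s i).get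
      (2 * (w.length * ((C + 1) * (K + 1) ^ d)) + Fintype.card X + 2)
      (A.passMemory E w c s (i + 1)).get := by
  have hL : ∀ u ∈ (A.nextWords E)^[i] [w], u ≠ [] := by
    cases i with
    | zero => simpa using hw
    | succ i =>
      intro u hu
      rw [Function.iterate_succ_apply'] at hu
      exact ne_nil_of_mem_nextWords hu
  have h := runs_passMachine (A := A) (E := E) (m := A.passMemory E w c s i) hL rfl rfl
  have h1 := sum_length_iterate_le hact i w
  have h2 := sum_length_iterate_le hact (i + 1) w
  have h3 : ∀ j ≤ K, w.length * ((C + 1) * (j + 1) ^ d) ≤ w.length * ((C + 1) * (K + 1) ^ d) :=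
    fun j hj => by gcongr
  have h4 := h3 i hi.le
  have h5 := h3 (i + 1) hi
  rw [Function.iterate_succ_apply'] at h2
  refine (h.mono (by omega)).congr_right (congrArg WPMemory.get ?_)
  ext1 <;> try rfl
  simp [passMemory, Function.iterate_succ_apply']

variable (A E) in
/-- The machine for the word problem: `c * ℓ ^ D` passes, where `ℓ` is the number of binary digits
of the length of the input. -/
noncomputable def wordProblemMachine [Finite S] [Fintype X] (D c : ℕ) (rep : I → List S) (r : ℕ)
    (hr : ∀ a, (rep a).length ≤ r) (e : S) : StackMachine (WPStack X D) (WPSymbol I S) :=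
  (expand rep r hr e).seq (setClock.seq (nest (iter (A.passMachine E) c) (List.finRange D)))

theorem runs_wordProblemMachine [Finite S] [Fintype X] {C d : ℕ}
    (hact : ∀ s n, A.activity E n s ≤ C * (n + 1) ^ d) (D c : ℕ) (rep : I → List S) (r : ℕ)
    (hr : ∀ a, (rep a).length ≤ r) (e : S) (w : List I) :
    ∃ c' s', (A.wordProblemMachine E D c rep r hr e).Runs
      (WPMemory.get ⟨w.map .inp, [], [], [], [], fun _ => [], fun _ => [], fun _ => []⟩)
      (w.length * (r + 2) + 1 + (w.length.size * (2 * w.length + 4) + 1 +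
        (w.length.size + 2) ^ D * (c * (2 * ((r * w.length + 1) *
          ((C + 1) * (c * w.length.size ^ D + 1) ^ d)) + Fintype.card X + 2) + 1 + 6)))
      (A.passMemory E (e :: w.reverse.flatMap rep) c' s' (c * w.length.size ^ D)).get := by
  set u := e :: w.reverse.flatMap rep with hu
  have hlen : u.length ≤ r * w.length + 1 := by
    rw [hu, List.length_cons, Nat.add_le_add_iff_right, List.length_flatMap]
    refine (List.sum_le_card_nsmul _ r fun a ha => ?_).trans (by simp [mul_comm])
    obtain ⟨i, -, rfl⟩ := List.mem_map.1 ha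
    exact hr i
  have h1 := (runs_expand (rep := rep) (hr := hr) (e := e) (w := w) (X := X) (D := D)
    (m := ⟨w.map .inp, [], [], [], [], fun _ => [], fun _ => [], fun _ => []⟩) rfl).congr_right
    (σ'' := WPMemory.get ⟨[], encodeWords [u], [], List.replicate w.length .mark, [], fun _ => [],
      fun _ => [], fun _ => []⟩)
    (congrArg WPMemory.get (by ext1 <;> simp [hu, encodeWords, markFirst]))
  have h2 := (runs_setClock (n := w.length) (c := 0) (m := (⟨[], encodeWords [u], [],
      List.replicate w.length .mark, [], fun _ => [], fun _ => [], fun _ => []⟩ :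
      WPMemory I S X D)) rfl rfl rfl).congr_right
    (σ'' := (A.passMemory (I := I) E u (fun _ : Fin D => List.replicate w.length.size .mark)
      (fun _ => []) 0).get)
    (congrArg WPMemory.get (by ext1 <;> simp [passMemory, passMarks]))
  set K := c * w.length.size ^ D with hK
  set B := 2 * (u.length * ((C + 1) * (K + 1) ^ d)) + Fintype.card X + 2 with hB
  have hbody : ∀ (i : ℕ) (c' s' : Fin D → List (WPSymbol I S)), i + c ≤ K →
      (iter (A.passMachine E) c).Runs
        (A.passMemory E u c' s' i).get (c * B + 1) (A.passMemory E u c' s' (i + c)).get :=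
    fun i c' s' hi =>
    runs_iter (σ := fun i => (A.passMemory E u c' s' i).get) (K := K)
      (fun i hi => runs_passMachine_passMemory hact (by simp [hu]) c' s' hi) c i hi
  have h3 := runs_nest (m := A.passMemory E u (fun _ => []) (fun _ => [])) (K := K) hbody
    (n := w.length.size) (l := List.finRange D) (List.nodup_finRange D)
    (c := fun _ => List.replicate w.length.size .mark) (s := fun _ => [])
    (fun _ _ => rfl) (fun _ _ => rfl) 0 (by simp [hK])
  rw [Nat.zero_add, List.length_finRange] at h3
  refine ⟨_, _, (h1.seq (h2.seq h3)).mono ?_⟩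
  have h4 : B ≤ 2 * ((r * w.length + 1) * ((C + 1) * (K + 1) ^ d)) + Fintype.card X + 2 := by
    rw [hB]; gcongr
  gcongr

end Words

end InvAutomaton

/-! ### Quasilinear running time -/

namespace InvAutomaton

/-- Of order `s ^ D` passes over lists of size `n * (s ^ D) ^ d` give the exponent `D + D * d`; the
cost `n * s` of the clock is absorbed as `1 ≤ D`. -/
theorem wordProblemMachine_time_le (r c C d D b s n : ℕ) (hD : 1 ≤ D) :
    n * (r + 2) + 1 + (s * (2 * n + 4) + 1 + (s + 2) ^ D *
      (c * (2 * ((r * n + 1) * ((C + 1) * (c * s ^ D + 1) ^ d)) + b + 2) + 1 + 6)) ≤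
    ((r + 2) + 1 + 4 + 1 + c * 2 * (r + 1) * (C + 1) * (c + 1) ^ d + (c * (b + 2) + 7)) *
      ((n + 1) * (s + 2) ^ (D * (d + 1))) := by
  have hz : 1 ≤ s + 2 := by omega
  set P := (s + 2) ^ (D * (d + 1)) with hP
  have hP1 : 1 ≤ P := Nat.one_le_pow _ _ hz
  have hzD : (s + 2) ^ D ≤ P := Nat.pow_le_pow_right hz (Nat.le_mul_of_pos_right _ (by omega))
  have hzP : s ≤ P := by
    have : (s + 2) ^ 1 ≤ (s + 2) ^ D := Nat.pow_le_pow_right hz hD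
    rw [pow_one] at this
    omega
  have hd : (s + 2) ^ D * (c * s ^ D + 1) ^ d ≤ (c + 1) ^ d * P := by
    have h1 : c * s ^ D + 1 ≤ (c + 1) * (s + 2) ^ D := by
      have h2 : s ^ D ≤ (s + 2) ^ D := Nat.pow_le_pow_left (by omega) D
      have h3 : 1 ≤ (s + 2) ^ D := Nat.one_le_pow _ _ hz
      rw [Nat.add_mul, Nat.one_mul]
      exact Nat.add_le_add (Nat.mul_le_mul_left _ h2) h3
    calc (s + 2) ^ D * (c * s ^ D + 1) ^ d ≤ (s + 2) ^ D * ((c + 1) * (s + 2) ^ D) ^ d := by gcongr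
      _ = (c + 1) ^ d * P := by rw [hP, mul_pow, ← pow_mul, mul_add, pow_add]; ring
  have h1 : n * (r + 2) ≤ (r + 2) * ((n + 1) * P) := by
    rw [mul_comm]
    exact Nat.mul_le_mul_left _ (n.le_succ.trans (Nat.le_mul_of_pos_right _ hP1))
  have h2 : 1 ≤ (n + 1) * P := Nat.mul_pos (by omega) hP1
  have h3 : s * (2 * n + 4) ≤ 4 * ((n + 1) * P) := by nlinarith
  have h4 : (s + 2) ^ D * (c * (2 * ((r * n + 1) * ((C + 1) * (c * s ^ D + 1) ^ d)))) ≤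
      c * 2 * (r + 1) * (C + 1) * (c + 1) ^ d * ((n + 1) * P) :=
    calc (s + 2) ^ D * (c * (2 * ((r * n + 1) * ((C + 1) * (c * s ^ D + 1) ^ d))))
        = c * 2 * (C + 1) * (r * n + 1) * ((s + 2) ^ D * (c * s ^ D + 1) ^ d) := by ring
      _ ≤ c * 2 * (C + 1) * ((r + 1) * (n + 1)) * ((c + 1) ^ d * P) := by
        gcongr
        nlinarith
      _ = _ := by ring
  have h5 : (s + 2) ^ D * (c * (b + 2) + 7) ≤ (c * (b + 2) + 7) * ((n + 1) * P) := by
    rw [mul_comm]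
    exact Nat.mul_le_mul_left _ (hzD.trans (Nat.le_mul_of_pos_left _ (by omega)))
  have h6 : (s + 2) ^ D *
      (c * (2 * ((r * n + 1) * ((C + 1) * (c * s ^ D + 1) ^ d)) + b + 2) + 1 + 6) =
      (s + 2) ^ D * (c * (2 * ((r * n + 1) * ((C + 1) * (c * s ^ D + 1) ^ d)))) +
      (s + 2) ^ D * (c * (b + 2) + 7) := by ring
  rw [h6]
  linarith

theorem isBigO_mul_size_pow (K : ℕ) :
    (fun n : ℕ => (((n + 1) * (n.size + 2) ^ K : ℕ) : ℝ)) =O[Filter.atTop]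
      fun n : ℕ => (n : ℝ) * Real.log n ^ K := by
  refine Asymptotics.IsBigO.of_bound (2 * 6 ^ K) ?_
  filter_upwards [Filter.eventually_ge_atTop 2] with n hn
  have hn' : (2 : ℝ) ≤ n := by exact_mod_cast hn
  have hl2 : (0.69 : ℝ) < Real.log 2 := by have := Real.log_two_gt_d9; linarith
  have hln : Real.log 2 ≤ Real.log n := Real.log_le_log (by norm_num) hn'
  have hs : 1 ≤ n.size := Nat.size_pos.2 (by omega)
  have hp : 2 ^ (n.size - 1) ≤ n := Nat.lt_size.1 (by omega)
  have h1 : ((n.size - 1 : ℕ) : ℝ) * Real.log 2 ≤ Real.log n := by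
    rw [← Real.log_pow]
    exact Real.log_le_log (by positivity) (by exact_mod_cast hp)
  rw [Nat.cast_sub hs, Nat.cast_one] at h1
  have hs' : (1 : ℝ) ≤ n.size := by exact_mod_cast hs
  -- Here `n.size - 1 ≤ log n / 0.69` and `3 ≤ 3 * log n / 0.69`, and `4 / 0.69 < 6`.
  have h2 : (n.size : ℝ) + 2 ≤ 6 * Real.log n := by nlinarith
  rw [Real.norm_of_nonneg (by positivity),
    Real.norm_of_nonneg (mul_nonneg (by positivity) (pow_nonneg (by linarith) _))]
  push_cast
  calc ((n : ℝ) + 1) * ((n.size : ℝ) + 2) ^ K ≤ (2 * n) * (6 * Real.log n) ^ K := by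
        gcongr
        linarith
    _ = _ := by rw [mul_pow]; ring

section Decision

variable {S X : Type} {A : InvAutomaton S X} {E : S → Prop}

/-- If words over `α` represent words of states whose nontriviality is visible on a level
polynomial in the logarithm of the length, and if the activity grows polynomially, then the words
that act trivially are recognised in quasilinear time. -/
theorem mem_DTIME_of_triv_level [Finite S] [Fintype X] {α : Type u} [Finite α] {C d c D : ℕ}
    (hE : ∀ s x, E s → A.t s x = s) (hEo : ∀ s, E s → A.o s = 1) {e : S} (he : E e)
    (hact : ∀ s n, A.activity E n s ≤ C * (n + 1) ^ d) (hD : 1 ≤ D) (rep : α → List S)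
    (hlevel : ∀ w : List α, A.triv (c * w.length.size ^ D) (w.reverse.flatMap rep) →
      ∀ k, A.triv k (w.reverse.flatMap rep)) :
    ({w | ∀ k, A.triv k (w.reverse.flatMap rep)} : Language α) ∈
      DTIME (fun n : ℕ => (n : ℝ) * Real.log n ^ (D * (d + 1))) α := by
  classical
  -- Stack symbols live in `Type`, so the input letters are numbered.
  obtain ⟨m, ⟨eqv⟩⟩ := Finite.exists_equiv_fin α
  obtain ⟨r, hr⟩ : ∃ r, ∀ a : Fin m, (rep (eqv.symm a)).length ≤ r := by
    obtain ⟨r, hr⟩ := (Set.finite_range fun a : Fin m => (rep (eqv.symm a)).length).bddAbove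
    exact ⟨r, fun a => hr ⟨a, rfl⟩⟩
  obtain ⟨N, hN⟩ := StackMachine.exists_decidesInTime
    (A.wordProblemMachine E D c (fun a => rep (eqv.symm a)) r hr e) .inp .flag
    (fun a : α => WPSymbol.inp (eqv a)) (fun a b h => eqv.injective (WPSymbol.inp.inj h))
    {w | ∀ k, A.triv k (w.reverse.flatMap rep)}
    (fun n => n * (r + 2) + 1 + (n.size * (2 * n + 4) + 1 + (n.size + 2) ^ D *
      (c * (2 * ((r * n + 1) * ((C + 1) * (c * n.size ^ D + 1) ^ d)) + Fintype.card X + 2) + 1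
        + 6)))
    (fun w => by
      obtain ⟨c', s', h⟩ := runs_wordProblemMachine hact D c (fun a => rep (eqv.symm a)) r hr e
        (w.map eqv)
      rw [List.length_map] at h
      have hrep : (w.map eqv).reverse.flatMap (fun a => rep (eqv.symm a)) =
          w.reverse.flatMap rep := by
        simp [← List.map_reverse, List.flatMap_map]
      rw [hrep] at h
      refine ⟨(A.passMemory E (e :: w.reverse.flatMap rep) c' s' (c * w.length.size ^ D)).get,
        ?_, ?_⟩
      · convert h using 1
        apply WPMemory.funext_get <;> simp
      · change A.passMarks E _ _ = [] ↔ _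
        rw [passMarks_eq_nil, ← forall_triv_iff hE hEo]
        simp only [List.mem_singleton, forall_eq]
        -- The auxiliary first state `e` is trivial and can be deleted.
        rw [← triv_filter hE hEo, List.filter_cons_of_neg (by simpa using he),
          triv_filter hE hEo]
        exact ⟨hlevel w, fun h => h _⟩)
  refine ⟨N, _, hN, ?_⟩
  refine Asymptotics.IsBigO.trans ?_ (isBigO_mul_size_pow (D * (d + 1)))
  refine Asymptotics.IsBigO.of_bound (2 * ((r + 2) + 1 + 4 + 1 + c * 2 * (r + 1) * (C + 1) *
    (c + 1) ^ d + (c * (Fintype.card X + 2) + 7) : ℕ) + 1 : ℕ) (Filter.Eventually.of_forall ?_)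
  intro n
  have h1 := wordProblemMachine_time_le r c C d D (Fintype.card X) n.size n hD
  have h2 : 1 ≤ (n + 1) * (n.size + 2) ^ (D * (d + 1)) := Nat.mul_pos (by omega) (by positivity)
  rw [Real.norm_natCast, Real.norm_natCast, ← Nat.cast_mul, Nat.cast_le]
  generalize ((r + 2) + 1 + 4 + 1 + c * 2 * (r + 1) * (C + 1) *
    (c + 1) ^ d + (c * (Fintype.card X + 2) + 7) : ℕ) = Q at h1 ⊢
  refine (?_ : _ ≤ 2 * (Q * _) + 1 * _).trans_eq (by rw [← mul_assoc, ← add_mul])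
  omega

end Decision

/-! ### Renaming of states and letters -/

section Transport

variable {S : Type u} {X : Type v} {S' : Type*} {X' : Type*}

/-- The automaton obtained by renaming the states and the letters. -/
def rename (A : InvAutomaton S X) (f : S ≃ S') (g : X ≃ X') : InvAutomaton S' X' where
  t s x := f (A.t (f.symm s) (g.symm x))
  o s := g.symm.trans ((A.o (f.symm s)).trans g)

variable (A : InvAutomaton S X) (f : S ≃ S') (g : X ≃ X')

theorem wout_rename (w : List S) (x : X) :
    (A.rename f g).wout (w.map f) (g x) = g (A.wout w x) := by
  induction w generalizing x with
  | nil => rfl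
  | cons s w ih => simpa [wout, rename] using ih _

theorem wstep_rename (w : List S) (x : X) :
    (A.rename f g).wstep (w.map f) (g x) = (A.wstep w x).map f := by
  induction w generalizing x with
  | nil => rfl
  | cons s w ih => simpa [wstep, rename] using ih _

theorem triv_rename (k : ℕ) (w : List S) : (A.rename f g).triv k (w.map f) ↔ A.triv k w := by
  induction k generalizing w with
  | zero => exact Iff.rfl
  | succ k ih =>
    refine and_congr ?_ ?_
    · rw [← g.forall_congr_right]
      simp [wout_rename]
    · rw [← g.forall_congr_right]
      simp [wstep_rename, ih]

theorem activity_rename [Fintype X] [Fintype X'] (E : S → Prop) (n : ℕ) (s : S) :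
    (A.rename f g).activity (fun s => E (f.symm s)) n (f s) = A.activity E n s := by
  induction n generalizing s with
  | zero => by_cases h : E s <;> simp [activity, h]
  | succ n ih =>
    simp only [activity]
    rw [← Equiv.sum_comp g]
    refine Finset.sum_congr rfl fun x _ => ?_
    rw [← ih]
    simp [rename]

end Transport

/-- `mem_DTIME_of_triv_level` for automata with states and letters in arbitrary universes. -/
theorem mem_DTIME_of_forall_triv {S : Type u} {X : Type v} {A : InvAutomaton S X} {E : S → Prop}
    [Finite S] [Fintype X] {α : Type*} [Finite α] {C d c D : ℕ}
    (hE : ∀ s x, E s → A.t s x = s) (hEo : ∀ s, E s → A.o s = 1) {e : S} (he : E e)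
    (hact : ∀ s n, A.activity E n s ≤ C * (n + 1) ^ d) (hD : 1 ≤ D) (rep : α → List S)
    (hlevel : ∀ w : List α, A.triv (c * w.length.size ^ D) (w.reverse.flatMap rep) →
      ∀ k, A.triv k (w.reverse.flatMap rep)) :
    ({w | ∀ k, A.triv k (w.reverse.flatMap rep)} : Language α) ∈
      DTIME (fun n : ℕ => (n : ℝ) * Real.log n ^ (D * (d + 1))) α := by
  obtain ⟨m, ⟨f⟩⟩ := Finite.exists_equiv_fin S
  obtain ⟨b, ⟨g⟩⟩ := Finite.exists_equiv_fin X
  have h0 : ∀ w : List α, w.reverse.flatMap (fun a => (rep a).map f) =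
      (w.reverse.flatMap rep).map f := fun w => by rw [List.map_flatMap]
  have h := mem_DTIME_of_triv_level (A := A.rename f g) (E := fun s => E (f.symm s)) (e := f e)
    (C := C) (d := d) (c := c) (fun s x h => by simp [rename, hE _ _ h])
    (fun s h => by ext; simp [rename, hEo _ h]) (by simpa using he)
    (fun s n => by
      obtain ⟨s, rfl⟩ := f.surjective s
      rw [activity_rename]
      exact hact s n) hD (fun a => (rep a).map f)
    (fun w => by simpa only [h0, triv_rename] using hlevel w)
  simpa only [h0, triv_rename] using h

end InvAutomaton

/-! ### From generators of the group to states -/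

/-- In the definition of `wordProblem` the list `w` is lifted to `G` by a monadic bind and then
mapped by the identity. -/
theorem mem_wordProblem {G : Type u} [Group G] {T : Set G} {w : List T} :
    w ∈ wordProblem T ↔ (w.map fun a : T => (a : G)).prod = 1 := by
  have h : (do let a ← w; pure (a : G)) = w.map fun a : T => (a : G) :=
    List.map_eq_flatMap.symm
  rw [← h, ← List.map_id' (do let a ← w; pure (a : G))]
  exact Iff.rfl

namespace InvAutomaton

theorem size_mul_add_one_le {r n : ℕ} (hn : n ≠ 0) :
    (r * n).size + 1 ≤ (r.size + 2) * n.size := by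
  have h1 : 0 < n.size := Nat.size_pos.2 (Nat.pos_of_ne_zero hn)
  have h2 : (r * n).size ≤ r.size + n.size := Nat.size_le.2 <| by
    rw [pow_add]
    exact Nat.mul_lt_mul'' (Nat.lt_size_self r) (Nat.lt_size_self n)
  nlinarith

/-- The level on which nontriviality is visible, in terms of the length over other generators. -/
theorem exists_triv_level_flatMap {S : Type u} {X : Type v} {A : InvAutomaton S X} {α : Type*}
    [Finite α] {K D : ℕ}
    (h : ∀ w : List S, A.triv (K * (w.length.size + 1) ^ D) w → ∀ k, A.triv k w)
    (rep : α → List S) :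
    ∃ c, ∀ w : List α, A.triv (c * w.length.size ^ D) (w.reverse.flatMap rep) →
      ∀ k, A.triv k (w.reverse.flatMap rep) := by
  obtain ⟨r, hr⟩ := (Set.finite_range fun a => (rep a).length).bddAbove
  refine ⟨K * (r.size + 2) ^ D, fun w hw => ?_⟩
  -- For the empty word the level can be zero; otherwise `1 ≤ w.length.size` absorbs additive
  -- constants.
  rcases eq_or_ne w [] with rfl | hw0
  · exact (A.element_eq_one_iff []).1 rfl
  · refine h _ (A.triv_mono ?_ hw)
    have hlen : (w.reverse.flatMap rep).length ≤ r * w.length := by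
      rw [List.length_flatMap]
      refine (List.sum_le_card_nsmul _ r fun a ha => ?_).trans (by simp [mul_comm])
      obtain ⟨i, -, rfl⟩ := List.mem_map.1 ha
      exact hr ⟨i, rfl⟩
    rw [mul_assoc, ← mul_pow]
    gcongr
    exact (Nat.add_le_add_right (Nat.size_le_size hlen) 1).trans
      (size_mul_add_one_le (by simpa using hw0))

section WordProblem

variable {S : Type u} {X : Type v} [Finite S] [Finite X] {A : InvAutomaton S X} {e : S} {d : ℕ}

/-- The word problem of a polynomial automaton group whose nontrivial elements are visible on a
level polynomial in the logarithm of the length. -/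
theorem IsPolynomialOfDegree.wordProblemIn (hmin : A.IsMinimal) (he : A.act e = 1)
    (hd : A.IsPolynomialOfDegree e d) {K D : ℕ} (hD : 1 ≤ D)
    (h : ∀ w : List (S ⊕ S), A.symmetrization.triv (K * (w.length.size + 1) ^ D) w →
      ∀ k, A.symmetrization.triv k w) :
    WordProblemIn A.group (DTIME fun n : ℕ => (n : ℝ) * Real.log n ^ (D * (d + 1))) := by
  have := Fintype.ofFinite X
  intro T hT _ _
  have : Finite T := hT
  choose rep hrep using fun a : T => exists_element_eq (a : A.group).2
  obtain ⟨c, hc⟩ := exists_triv_level_flatMap h rep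
  obtain ⟨C, hC⟩ := hd.exists_activity_le
  have ho := o_eq_one_of_act_eq_one he
  have key := mem_DTIME_of_forall_triv (A := A.symmetrization)
    (E := fun s => s = Sum.inl e ∨ s = Sum.inr e) (e := Sum.inl e)
    (by rintro s x (rfl | rfl) <;> simp [symmetrization, hmin.t_eq he])
    (by rintro s (rfl | rfl) <;> simp [symmetrization, ho])
    (Or.inl rfl) hC hD rep hc
  refine (congrArg (· ∈ DTIME (fun n : ℕ => (n : ℝ) * Real.log n ^ (D * (d + 1))) T)
    (Set.ext fun w => ?_)).mpr key
  refine mem_wordProblem.trans ?_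
  change _ ↔ ∀ k, A.symmetrization.triv k (w.reverse.flatMap rep)
  rw [← element_eq_one_iff, ← OneMemClass.coe_eq_one]
  have : A.symmetrization.element (w.reverse.flatMap rep) =
      (((w.map fun a : T => (a : A.group)).prod : A.group) : Equiv.Perm (List X)) := by
    induction w with
    | nil => rfl
    | cons a w ih =>
      rw [List.reverse_cons, List.flatMap_append, element_append, ih]
      simp [hrep]
  rw [this]

end WordProblem

end InvAutomaton

theorem theorem5 {S : Type u} {X : Type v} [Finite S] [Finite X] (A : InvAutomaton S X)
    (hmin : A.IsMinimal) (e : S) (he : A.act e = 1) (d : ℕ) (hd : A.IsPolynomialOfDegree e d) :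
    WordProblemIn A.group (DTIME fun n : ℕ => (n : ℝ) * Real.log n ^ ((d + 1) ^ 2)) ∧
    (A.IsContracting →
      WordProblemIn A.group (DTIME fun n : ℕ => (n : ℝ) * Real.log n ^ (d + 1))) := by
  constructor
  · have := Fintype.ofFinite X
    obtain ⟨C, hC⟩ := hd.exists_activity_le
    obtain ⟨K, hK⟩ := InvAutomaton.exists_triv_level (A := A.symmetrization)
      (E := fun s => s = Sum.inl e ∨ s = Sum.inr e)
      (by rintro s x (rfl | rfl) <;>
        simp [InvAutomaton.symmetrization, hmin.t_eq he,
          InvAutomaton.o_eq_one_of_act_eq_one he]) hC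
    rw [sq]
    exact hd.wordProblemIn hmin he (Nat.le_add_left 1 d) hK
  · rintro ⟨k, -, N, hN⟩
    -- Pieces of a single length suffice; the maximum with `1` makes that length positive.
    obtain ⟨K, hK⟩ := InvAutomaton.Shortens.exists_triv_level (A := A.symmetrization) (k := k)
      (N := max N 1) (fun w hw v hv => hw ▸ hN w (hw ▸ le_max_left _ _) v hv) (by simp)
    have h := hd.wordProblemIn hmin he le_rfl (K := K) (by simpa only [pow_one] using hK)
    rwa [one_mul] at h
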